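/- Let $P$ be a finite $T_0$ space, equivalently a finite poset (the open sets are the lower sets, continuous maps are the order preserving maps, and mapping spaces carry the pointwise order), and let $n\ge 2$. The symmetric group $\Sigma_n$ acts on $n$-tuples by $g(x_1,\dots,x_n)=(x_{g(1)},\dots,x_{g(n)})$. All "least numbers" below are $\infty$ if no such number exists. Then $$\mathrm{CC}^\Sigma_n(P)=\mathrm{SC}^\Sigma_n(\mathcal K(P))=\mathrm{TC}^\Sigma_n(|\mathcal K(P)|)\quad\text{in }\{0,1,2,\dots\}\cup\{\infty\},$$ where the terms are defined as follows. (0) $\mathcal K(P)$ is the order complex of $P$: its vertices are the points of $P$, its simplices the nonempty finite chains, and its vertices are ordered as in $P$. For a simplicial complex $K$, $\mathcal X(K)$ is the poset of its simplices under inclusion; $\mathrm{sd}(K)=\mathcal K(\mathcal X(K))$, with vertices ordered by inclusion of simplices, and $\mathrm{sd}(Q)=\mathcal X(\mathcal K(Q))$ for a poset $Q$; $\mathrm{sd}^r$ is the $r$-fold iterate, with the induced $\Sigma_n$-action. An ordered simplicial complex is a simplicial complex with a partial order on its vertices that is total on each simplex. $|K|$ is the geometric realization of a finite complex $K$. (1)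 Let $J_{n,m}$ be the poset $\{0\}\cup\{t_j: 1\le t\le m,\ 1\le j\le n\}$ made of $n$ fences $0\le 1_j\ge 2_j\le 3_j\ge\cdots m_j$ with common origin $0=0_j$. Let $q_{n,m}:P^{J_{n,m}}\to P^n$, $\gamma\mapsto(\gamma(m_1),\dots,\gamma(m_n))$, where $\Sigma_n$ acts on $P^{J_{n,m}}$ by $(g\gamma)(t_j)=\gamma(t_{g(j)})$. Let $\tau^r:\mathrm{sd}^r(P^n)\to P^n$ be the iterate of the maps that send a chain to its last element. $\mathrm{CC}^{\Sigma,r}_{n,m}(P)$ is the least $k\ge 0$ such that $\mathrm{sd}^r(P^n)$ has a cover by $\Sigma_n$-invariant open sets $Q_1,\dots,Q_k$ with continuous $\Sigma_n$-equivariant maps $s_i:Q_i\to P^{J_{n,m}}$ satisfying $q_{n,m}\circ s_i=\tau^r|_{Q_i}$. It is non-increasing in $m$; $\mathrm{CC}^{\Sigma,r}_n(P)$ is its stable value $\min_m\mathrm{CC}^{\Sigma,r}_{n,m}(P)$, and $\mathrm{CC}^\Sigma_n(P)=\min_{r\ge 0}\mathrm{CC}^{\Sigma,r}_n(P)$. (2)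 Let $K$ be an ordered simplicial complex with vertex set $V$. $K^n$ is the ordered complex with vertex set $V^n$, ordered componentwise, whose simplices are the nonempty finite chains all of whose coordinate projections are simplices of $K$. Let $\pi_j:\mathrm{sd}^r(K^n)\to K$ be the iterate $\mathrm{sd}^r(K^n)\to K^n$ of the last-vertex maps followed by the $j$-th projection. $\mathrm{SC}^{\Sigma,r}_n(K)$ is the least $k\ge 0$ such that $\mathrm{sd}^r(K^n)$ is covered by $\Sigma_n$-invariant subcomplexes $L_1,\dots,L_k$, on each of which $\pi_1,\dots,\pi_n$ are symmetrically contiguous: there are $c\ge1$, a simplicial map $\varphi_*:L_i\to K$ with $\varphi_*(gv)=\varphi_*(v)$, and simplicial maps $\varphi^l_j:L_i\to K$ ($0\le l\le c$, $1\le j\le n$) with $\varphi^0_j=\varphi_*$, $\varphi^c_j=\pi_j|_{L_i}$, $\varphi^l_j(gv)=\varphi^l_{g(j)}(v)$ for all vertices $v$ and all $g\in\Sigma_n$, and $\varphi^{l-1}_j(\sigma)\cup\varphi^l_j(\sigma)$ a simplex of $K$ for every simplex $\sigma$ of $L_i$ and $1\le l\le c$. $\mathrm{SC}^\Sigma_n(K)=\min_{r\ge0}\mathrm{SC}^{\Sigma,r}_n(K)$.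 (3) Let $X$ be a topological space, $I_n$ the wedge of $n$ copies of $[0,1]$ glued at $0$, with points $t_j$, and $e_n:X^{I_n}\to X^n$, $\alpha\mapsto(\alpha(1_1),\dots,\alpha(1_n))$, where $X^{I_n}$ has the compact-open topology and the action $(g\alpha)(t_j)=\alpha(t_{g(j)})$. $\mathrm{TC}^\Sigma_n(X)$ is the least $k\ge0$ such that $X^n$ is covered by $k$ $\Sigma_n$-invariant open sets, on each of which $e_n$ has a continuous $\Sigma_n$-equivariant section. -/

import Mathlib

universe u

noncomputable section

namespace SymComplexity

/-- The least natural number with property `p`, and `∞` if there is none. -/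
def leastNat (p : ℕ → Prop) : ℕ∞ := ⨅ (k : ℕ) (_ : p k), (k : ℕ∞)

/-- The image `f(s)` of a finite set. -/
def img {V W : Type u} (f : V → W) (s : Finset V) : Finset W :=
  @Finset.image V W (Classical.decEq W) f s

theorem mem_img {V W : Type u} (f : V → W) (s : Finset V) (w : W) :
    w ∈ img f s ↔ ∃ v ∈ s, f v = w :=
  @Finset.mem_image V W (Classical.decEq W) f s w

theorem coe_img {V W : Type u} (f : V → W) (s : Finset V) :
    (img f s : Set W) = f '' (s : Set V) :=
  @Finset.coe_image V W (Classical.decEq W) f s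

theorem img_nonempty {V W : Type u} (f : V → W) {s : Finset V} (hs : s.Nonempty) :
    (img f s).Nonempty :=
  @Finset.Nonempty.image V W (Classical.decEq W) s hs f

theorem img_mono {V W : Type u} (f : V → W) {s t : Finset V} (h : s ⊆ t) : img f s ⊆ img f t :=
  @Finset.image_subset_image V W (Classical.decEq W) f s t h

theorem img_img {U V W : Type u} (f : V → W) (g : U → V) (s : Finset U) :
    img f (img g s) = img (fun x => f (g x)) s := by
  ext w
  simp only [mem_img]
  constructor
  · rintro ⟨_, ⟨x, hx, rfl⟩, rfl⟩
    exact ⟨x, hx, rfl⟩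
  · rintro ⟨x, hx, rfl⟩
    exact ⟨_, ⟨x, hx, rfl⟩, rfl⟩

theorem img_singleton {V W : Type u} (f : V → W) (v : V) : img f {v} = {f v} :=
  @Finset.image_singleton V W (Classical.decEq W) f v

theorem img_isChain {V W : Type u} [PartialOrder V] [PartialOrder W] (f : V → W)
    (hf : Monotone f) {s : Finset V} (hs : IsChain (· ≤ ·) (s : Set V)) :
    IsChain (· ≤ ·) (img f s : Set W) := by
  rw [coe_img]
  rintro _ ⟨x, hx, rfl⟩ _ ⟨y, hy, rfl⟩ -
  exact (hs.total hx hy).imp (fun h => hf h) (fun h => hf h)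

/-! ### Order complexes, face posets, last vertices -/

/-- A nonempty finite chain has a last element. -/
theorem exists_last {Q : Type u} [PartialOrder Q] (s : Finset Q) (hne : s.Nonempty)
    (hs : IsChain (· ≤ ·) (s : Set Q)) : ∃ v ∈ s, ∀ w ∈ s, w ≤ v := by
  obtain ⟨v, hv⟩ := s.exists_maximal hne
  refine ⟨v, hv.prop, fun w hw => ?_⟩
  rcases hs.total (Finset.mem_coe.2 hw) (Finset.mem_coe.2 hv.prop) with h | h
  · exact h
  · exact hv.le_of_ge hw h

/-- The last (largest) element of a nonempty finite chain. -/
def last {Q : Type u} [PartialOrder Q] (s : Finset Q) (hne : s.Nonempty)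
    (hs : IsChain (· ≤ ·) (s : Set Q)) : Q :=
  (exists_last s hne hs).choose

theorem last_mem {Q : Type u} [PartialOrder Q] (s : Finset Q) (hne : s.Nonempty)
    (hs : IsChain (· ≤ ·) (s : Set Q)) : last s hne hs ∈ s :=
  (exists_last s hne hs).choose_spec.1

theorem le_last {Q : Type u} [PartialOrder Q] (s : Finset Q) (hne : s.Nonempty)
    (hs : IsChain (· ≤ ·) (s : Set Q)) {w : Q} (hw : w ∈ s) : w ≤ last s hne hs :=
  (exists_last s hne hs).choose_spec.2 w hw

/-- The order complex `𝒦(P)`: its vertices are the elements of `P`, its simplices the nonempty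
finite chains. -/
def orderComplex (P : Type u) [PartialOrder P] : AbstractSimplicialComplex P where
  faces := {s | s.Nonempty ∧ IsChain (· ≤ ·) (s : Set P)}
  isRelLowerSet_faces := fun {_} h =>
    ⟨h.1, fun _ hts ht => ⟨ht, h.2.mono (Finset.coe_subset.2 hts)⟩⟩
  singleton_mem v := ⟨Finset.singleton_nonempty v, by simp⟩

/-- The face poset `𝒳(K)`: the simplices of `K`, ordered by inclusion. -/
abbrev FacePoset {V : Type u} (K : AbstractSimplicialComplex V) : Type u :=
  {s : Finset V // s ∈ K.faces}

/-! ### Finite spaces: barycentric subdivision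

A finite `T₀` space is a finite poset: its open sets are the lower sets, its continuous maps the
monotone maps, and a mapping space is the set of monotone maps with the pointwise order. -/

/-- The barycentric subdivision `sd(Q) = 𝒳(𝒦(Q))` of a poset. -/
def sd (Q : PartOrd.{u}) : PartOrd.{u} := PartOrd.of (FacePoset (orderComplex Q))

/-- The map `τ_Q : sd(Q) → Q` that sends a chain to its last element. -/
def tau (Q : PartOrd.{u}) : sd Q →o Q where
  toFun s := last s.1 s.2.1 s.2.2
  monotone' s t hst := le_last t.1 t.2.1 t.2.2 (hst (last_mem s.1 s.2.1 s.2.2))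

/-- The map `sd(Q) → sd(R)` induced by a monotone map `Q → R`: take images of chains. -/
def sdMap {Q R : PartOrd.{u}} (f : Q →o R) : sd Q →o sd R where
  toFun s := ⟨img f s.1, img_nonempty f s.2.1, img_isChain f f.monotone s.2.2⟩
  monotone' _ _ hst := img_mono f hst

/-- The iterated barycentric subdivision `sd^r(Q)`. -/
def sdIter (Q : PartOrd.{u}) : ℕ → PartOrd.{u}
  | 0 => Q
  | r + 1 => sd (sdIter Q r)

/-- `τ^r_Q : sd^r(Q) → Q`. -/
def tauIter (Q : PartOrd.{u}) : ∀ r : ℕ, sdIter Q r →o Q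
  | 0 => OrderHom.id
  | r + 1 => (tauIter Q r).comp (tau (sdIter Q r))

/-- The map `sd^r(Q) → sd^r(R)` induced by a monotone map `Q → R`. -/
def sdIterMap {Q R : PartOrd.{u}} (f : Q →o R) : ∀ r : ℕ, sdIter Q r →o sdIter R r
  | 0 => f
  | r + 1 => sdMap (sdIterMap f r)

/-- The poset `P^n` with the componentwise order. -/
def powPoset (P : Type u) [PartialOrder P] (n : ℕ) : PartOrd.{u} := PartOrd.of (Fin n → P)

/-- `g (x₁, …, xₙ) = (x_{g(1)}, …, x_{g(n)})` on `P^n`. -/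
def permPoset (P : Type u) [PartialOrder P] {n : ℕ} (g : Equiv.Perm (Fin n)) :
    powPoset P n →o powPoset P n where
  toFun x := fun j => x (g j)
  monotone' _ _ h := fun j => h (g j)

/-- The action of `g` on `sd^r(P^n)`. -/
def sdAct (P : Type u) [PartialOrder P] {n : ℕ} (r : ℕ) (g : Equiv.Perm (Fin n)) :
    sdIter (powPoset P n) r →o sdIter (powPoset P n) r :=
  sdIterMap (permPoset P g) r

/-! ### The fences `J_{n,m}` -/

/-- The points of `J_{n,m}`: the common origin `0`, and `pt t j` for the point `(t+1)_j`. -/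
inductive Fence (n m : ℕ) : Type
  | zero : Fence n m
  | pt (t : Fin m) (j : Fin n) : Fence n m

namespace Fence

variable {n m : ℕ}

/-- The point `t_j`, for `0 ≤ t ≤ m`; all the points `0_j` are the origin. -/
def mk (t : ℕ) (ht : t ≤ m) (j : Fin n) : Fence n m :=
  match t, ht with
  | 0, _ => zero
  | t + 1, ht => pt ⟨t, ht⟩ j

/-- The parameter `t` of the point `t_j`. -/
def level : Fence n m → ℕ
  | zero => 0
  | pt t _ => t + 1

theorem level_mk (t : ℕ) (ht : t ≤ m) (j : Fin n) : (mk t ht j : Fence n m).level = t := by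
  cases t <;> rfl

/-- The order `0 ≤ 1_j ≥ 2_j ≤ 3_j ≥ ⋯` on each of the `n` fences: apart from reflexivity,
`t_j ≤ s_j` when `t` is even, `s` is odd and `t`, `s` are neighbours. -/
protected def Le (x y : Fence n m) : Prop :=
  x = y ∨ ∃ (t s : ℕ) (ht : t ≤ m) (hs : s ≤ m) (j : Fin n),
    x = mk t ht j ∧ y = mk s hs j ∧ Even t ∧ Odd s ∧ (s = t + 1 ∨ t = s + 1)

theorem Le.parity {x y : Fence n m} (h : Fence.Le x y) :
    x = y ∨ (Even x.level ∧ Odd y.level) := by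
  rcases h with h | ⟨t, s, ht, hs, j, rfl, rfl, he, ho, -⟩
  · exact Or.inl h
  · exact Or.inr ⟨by rwa [level_mk], by rwa [level_mk]⟩

instance : PartialOrder (Fence n m) where
  le := Fence.Le
  le_refl _ := Or.inl rfl
  le_trans x y z hxy hyz := by
    rcases hxy.parity with rfl | ⟨-, ho⟩
    · exact hyz
    · rcases hyz.parity with rfl | ⟨he, -⟩
      · exact hxy
      · exact absurd he (Nat.not_even_iff_odd.2 ho)
  le_antisymm x y hxy hyx := by
    rcases hxy.parity with h | ⟨he, -⟩
    · exact h
    · rcases hyx.parity with h | ⟨-, ho⟩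
      · exact h.symm
      · exact absurd he (Nat.not_even_iff_odd.2 ho)

/-- `g (t_j) = t_{g(j)}`. -/
def perm (g : Equiv.Perm (Fin n)) : Fence n m → Fence n m
  | zero => zero
  | pt t j => pt t (g j)

end Fence

/-- `q_{n,m} : P^{J_{n,m}} → P^n`, `γ ↦ (γ(m_1), …, γ(m_n))`. -/
def fenceEnds (P : Type u) [PartialOrder P] (n m : ℕ) (γ : Fence n m →o P) : powPoset P n :=
  fun j : Fin n => γ (Fence.mk m le_rfl j)

/-! ### Symmetric combinatorial complexity -/

/-- `CC^{Σ,r}_{n,m}(P)`: the least `k` such that `sd^r(P^n)` has a cover by `k` invariant open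
sets (lower sets) `Q i`, each with an equivariant continuous (monotone) map
`s i : Q i → P^{J_{n,m}}` such that `q_{n,m} ∘ s i = τ^r`. -/
def CCrm (n m r : ℕ) (P : Type u) [PartialOrder P] : ℕ∞ :=
  leastNat fun k => ∃ Q : Fin k → Set (sdIter (powPoset P n) r),
    (∀ i, IsLowerSet (Q i)) ∧
    (∀ i, ∀ g : Equiv.Perm (Fin n), ∀ x ∈ Q i, sdAct P r g x ∈ Q i) ∧
    (∀ x, ∃ i, x ∈ Q i) ∧
    ∀ i, ∃ s : Q i → (Fence n m →o P),
      Monotone s ∧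
      (∀ (g : Equiv.Perm (Fin n)) (x y : Q i), y.1 = sdAct P r g x.1 →
        ∀ a : Fence n m, s y a = s x (Fence.perm g a)) ∧
      ∀ x : Q i, fenceEnds P n m (s x) = tauIter (powPoset P n) r x.1

/-- `CC^{Σ,r}_n(P)`: the stable value of the decreasing sequence `m ↦ CC^{Σ,r}_{n,m}(P)`. -/
def CCr (n r : ℕ) (P : Type u) [PartialOrder P] : ℕ∞ := ⨅ m : ℕ, CCrm n m r P

/-- The symmetric combinatorial complexity `CC^Σ_n(P)`. -/
def CC (n : ℕ) (P : Type u) [PartialOrder P] : ℕ∞ := ⨅ r : ℕ, CCr n r P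

/-! ### Ordered simplicial complexes -/

/-- An ordered simplicial complex: a simplicial complex with a partial order on its vertices that
is total on each simplex. -/
structure OrdComplex : Type (u + 1) where
  /-- the vertices -/
  V : Type u
  [order : PartialOrder V]
  /-- the underlying simplicial complex -/
  cpx : AbstractSimplicialComplex V
  isChain : ∀ s ∈ cpx.faces, IsChain (· ≤ ·) (s : Set V)

attribute [instance] OrdComplex.order

/-- A simplicial map: a map of vertices that sends simplices to simplices. -/
structure SimplicialMap (K L : OrdComplex.{u}) : Type u where
  toFun : K.V → L.V
  map_faces : ∀ s ∈ K.cpx.faces, img toFun s ∈ L.cpx.faces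

namespace OrdComplex

/-- The order complex of a poset, with the order of the poset. -/
def ofPoset (P : Type u) [PartialOrder P] : OrdComplex.{u} where
  V := P
  cpx := orderComplex P
  isChain _ hs := hs.2

/-- The cartesian power `K^n`: the vertices are the `n`-tuples of vertices with the componentwise
order, the simplices are the chains whose projections to all the factors are simplices. -/
def pow (K : OrdComplex.{u}) (n : ℕ) : OrdComplex.{u} where
  V := Fin n → K.V
  cpx :=
    { faces := {s | s.Nonempty ∧ IsChain (· ≤ ·) (s : Set (Fin n → K.V)) ∧
        ∀ j, img (fun x => x j) s ∈ K.cpx.faces}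
      isRelLowerSet_faces := fun {_} h => ⟨h.1, fun _ hts ht =>
        ⟨ht, h.2.1.mono (Finset.coe_subset.2 hts), fun j =>
          (K.cpx.isRelLowerSet_faces (h.2.2 j)).2 (img_mono _ hts) (img_nonempty _ ht)⟩⟩
      singleton_mem := fun v => ⟨Finset.singleton_nonempty v, by simp, fun j => by
        rw [img_singleton]
        exact K.cpx.singleton_mem (v j)⟩ }
  isChain _ hs := hs.2.1

/-- `g (x₁, …, xₙ) = (x_{g(1)}, …, x_{g(n)})` on `K^n`. -/
def perm (K : OrdComplex.{u}) {n : ℕ} (g : Equiv.Perm (Fin n)) :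
    SimplicialMap (K.pow n) (K.pow n) where
  toFun (x : Fin n → K.V) := fun j : Fin n => x (g j)
  map_faces (s : Finset (Fin n → K.V)) hs :=
    ⟨img_nonempty _ hs.1,
      img_isChain (fun (x : Fin n → K.V) (j : Fin n) => x (g j))
        (fun (x y : Fin n → K.V) (h : x ≤ y) j => h (g j)) hs.2.1,
      fun j => (img_img (fun x : Fin n → K.V => x j)
        (fun (x : Fin n → K.V) (j : Fin n) => x (g j)) s).symm ▸ hs.2.2 (g j)⟩

/-- The barycentric subdivision `sd(K) = 𝒦(𝒳(K))`, ordered by inclusion of simplices. -/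
def sd (K : OrdComplex.{u}) : OrdComplex.{u} := ofPoset (FacePoset K.cpx)

/-- The map `ι_K : sd(K) → K` that sends a simplex to its last vertex. -/
def iota (K : OrdComplex.{u}) : SimplicialMap K.sd K where
  toFun (s : FacePoset K.cpx) := last s.1 (K.cpx.isRelLowerSet_faces s.2).1 (K.isChain s.1 s.2)
  map_faces (c : Finset (FacePoset K.cpx)) hc := by
    obtain ⟨t, -, htop⟩ := exists_last c hc.1 hc.2
    refine (K.cpx.isRelLowerSet_faces t.2).2 ?_ (img_nonempty _ hc.1)
    intro v hv
    obtain ⟨s, hs, rfl⟩ := (mem_img _ _ _).1 hv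
    exact htop s hs (last_mem s.1 (K.cpx.isRelLowerSet_faces s.2).1 (K.isChain s.1 s.2))

/-- The map `sd(K) → sd(L)` induced by a simplicial map: take images of simplices. -/
def sdMap {K L : OrdComplex.{u}} (f : SimplicialMap K L) : SimplicialMap K.sd L.sd where
  toFun (s : FacePoset K.cpx) := (⟨img f.toFun s.1, f.map_faces s.1 s.2⟩ : FacePoset L.cpx)
  map_faces _ hc :=
    ⟨img_nonempty _ hc.1, img_isChain
      (fun s : FacePoset K.cpx => (⟨img f.toFun s.1, f.map_faces s.1 s.2⟩ : FacePoset L.cpx))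
      (fun _ _ h => img_mono _ h) hc.2⟩

/-- The iterated barycentric subdivision `sd^r(K)`. -/
def sdIter (K : OrdComplex.{u}) : ℕ → OrdComplex.{u}
  | 0 => K
  | r + 1 => (sdIter K r).sd

/-- `ι^r_K : sd^r(K) → K` on vertices. -/
def iotaIter (K : OrdComplex.{u}) : ∀ r : ℕ, (K.sdIter r).V → K.V
  | 0 => id
  | r + 1 => fun v => iotaIter K r ((iota (K.sdIter r)).toFun v)

/-- The map `sd^r(K) → sd^r(L)` induced by a simplicial map. -/
def sdIterMap {K L : OrdComplex.{u}} (f : SimplicialMap K L) :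
    ∀ r : ℕ, SimplicialMap (K.sdIter r) (L.sdIter r)
  | 0 => f
  | r + 1 => sdMap (sdIterMap f r)

/-- The action of `g` on the vertices of `sd^r(K^n)`. -/
def sdAct (K : OrdComplex.{u}) {n : ℕ} (r : ℕ) (g : Equiv.Perm (Fin n)) :
    ((K.pow n).sdIter r).V → ((K.pow n).sdIter r).V :=
  (sdIterMap (K.perm g) r).toFun

/-- `π_j = p_j ∘ ι^r : sd^r(K^n) → K` on vertices. -/
def proj (K : OrdComplex.{u}) {n : ℕ} (r : ℕ) (j : Fin n) : ((K.pow n).sdIter r).V → K.V :=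
  fun v => ((K.pow n).iotaIter r v : Fin n → K.V) j

end OrdComplex

/-! ### Symmetric simplicial complexity -/

open scoped Classical in
/-- The maps `φ 1, …, φ n : L → K` are symmetrically contiguous, where `L` is a subcomplex of a
complex with vertex set `W`, and `Σ_n` acts on `W` by `act`, preserving `L`. The vertices of `L` are
the `v` with `{v} ∈ L.faces`; maps on the vertices of `L` are written as maps on `W`, whose values
at other points play no role. The maps `Φ l j` are the members of the contiguity chain, from
`Φ 0 j = φ_*` to `Φ c j = φ j`. -/
def SymContiguous {n : ℕ} {W V : Type u} (act : Equiv.Perm (Fin n) → W → W)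
    (L : PreAbstractSimplicialComplex W) (K : AbstractSimplicialComplex V)
    (φ : Fin n → W → V) : Prop :=
  ∃ (φs : W → V) (c : ℕ) (Φ : ℕ → Fin n → W → V),
    0 < c ∧
    (∀ l ≤ c, ∀ j, ∀ s ∈ L.faces, img (Φ l j) s ∈ K.faces) ∧
    (∀ j, ∀ v, {v} ∈ L.faces → Φ 0 j v = φs v) ∧
    (∀ j, ∀ v, {v} ∈ L.faces → Φ c j v = φ j v) ∧
    (∀ l < c, ∀ j, ∀ s ∈ L.faces, img (Φ l j) s ∪ img (Φ (l + 1) j) s ∈ K.faces) ∧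
    (∀ g v, {v} ∈ L.faces → φs (act g v) = φs v) ∧
    (∀ l ≤ c, ∀ j g v, {v} ∈ L.faces → Φ l j (act g v) = Φ l (g j) v)

/-- `SC^{Σ,r}_n(K)`: the least `k` such that `sd^r(K^n)` is covered by `k` symmetric subcomplexes,
on each of which `π_1, …, π_n` are symmetrically contiguous. -/
def SCr (n r : ℕ) (K : OrdComplex.{u}) : ℕ∞ :=
  leastNat fun k => ∃ L : Fin k → PreAbstractSimplicialComplex ((K.pow n).sdIter r).V,
    (∀ i, (L i).faces ⊆ ((K.pow n).sdIter r).cpx.faces) ∧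
    (∀ i, ∀ g : Equiv.Perm (Fin n), ∀ s ∈ (L i).faces, img (K.sdAct r g) s ∈ (L i).faces) ∧
    (∀ s ∈ ((K.pow n).sdIter r).cpx.faces, ∃ i, s ∈ (L i).faces) ∧
    ∀ i, SymContiguous (fun g => K.sdAct r g) (L i) K.cpx (fun j => K.proj r j)

/-- The symmetric simplicial complexity `SC^Σ_n(K)`. -/
def SC (n : ℕ) (K : OrdComplex.{u}) : ℕ∞ := ⨅ r : ℕ, SCr n r K

/-! ### Symmetric topological complexity -/

/-- The geometric realization `|K|` of a finite complex: the functions `α : V → [0,1]` with sum `1`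
whose support is a simplex, with the topology of `V → ℝ`. -/
def realization {V : Type u} [Fintype V] (K : AbstractSimplicialComplex V) : Set (V → ℝ) :=
  {α | α ∈ stdSimplex ℝ V ∧ ∃ s ∈ K.faces, (s : Set V) = Function.support α}

/-- Equality in the wedge of intervals: all the points `(j, 0)` are identified. -/
def wedgeSetoid (n : ℕ) : Setoid (Fin n × unitInterval) where
  r a b := a = b ∨ (a.2 = 0 ∧ b.2 = 0)
  iseqv :=
    { refl := fun _ => Or.inl rfl
      symm := by
        rintro a b (rfl | ⟨h, h'⟩)
        · exact Or.inl rfl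
        · exact Or.inr ⟨h', h⟩
      trans := by
        rintro a b c (rfl | ⟨h, h'⟩) (rfl | ⟨k, k'⟩)
        · exact Or.inl rfl
        · exact Or.inr ⟨k, k'⟩
        · exact Or.inr ⟨h, h'⟩
        · exact Or.inr ⟨h, k'⟩ }

/-- `I_n`: the wedge of `n` unit intervals at their origins, with the quotient topology. -/
abbrev Wedge (n : ℕ) : Type := Quotient (wedgeSetoid n)

/-- The point `t_j` of `I_n`. -/
def Wedge.mk {n : ℕ} (t : unitInterval) (j : Fin n) : Wedge n :=
  Quotient.mk (wedgeSetoid n) (j, t)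

/-- `g (t_j) = t_{g(j)}` on `I_n`. -/
def Wedge.perm {n : ℕ} (g : Equiv.Perm (Fin n)) : C(Wedge n, Wedge n) where
  toFun := Quotient.map (fun a => (g a.1, a.2)) (by
    rintro a b (rfl | h)
    · exact Or.inl rfl
    · exact Or.inr h)
  continuous_toFun := Continuous.quotient_map'
    ((continuous_of_discreteTopology.comp continuous_fst).prodMk continuous_snd) _

/-- The equivariant sectional category of `q : E → B`, where each `g : G` acts on `E` and `B` by
`actE g` and `actB g`: the least `k` such that `B` is covered by `k` invariant open sets, each with a
continuous equivariant section of `q`. -/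
def equivariantSecat {G E B : Type*} [TopologicalSpace E] [TopologicalSpace B]
    (actE : G → E → E) (actB : G → B → B) (q : E → B) : ℕ∞ :=
  leastNat fun k => ∃ U : Fin k → Set B,
    (∀ i, IsOpen (U i)) ∧
    (∀ i, ∀ g : G, ∀ x ∈ U i, actB g x ∈ U i) ∧
    (∀ x, ∃ i, x ∈ U i) ∧
    ∀ i, ∃ s : U i → E, Continuous s ∧ (∀ x : U i, q (s x) = x) ∧
      ∀ (g : G) (x y : U i), y.1 = actB g x.1 → s y = actE g (s x)

/-- The symmetric topological complexity `TC^Σ_n(X)`: the equivariant sectional category of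
`e_n : X^{I_n} → X^n`, `α ↦ (α(1_1), …, α(1_n))`, for the actions of `Σ_n` given by
`(g α)(t_j) = α(t_{g(j)})` and `g (x₁, …, xₙ) = (x_{g(1)}, …, x_{g(n)})`. -/
def TC (n : ℕ) (X : Type u) [TopologicalSpace X] : ℕ∞ :=
  equivariantSecat (G := Equiv.Perm (Fin n)) (E := C(Wedge n, X)) (B := Fin n → X)
    (fun g α => α.comp (Wedge.perm g))
    (fun g x => fun j => x (g j))
    (fun α => fun j => α (Wedge.mk 1 j))

end SymComplexity

end

noncomputable section

namespace SymComplexity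

/-! ### Least numbers and last elements -/

/-! The three numbers are compared in a cycle, `CC_le_SC`, `SC_le_TC` and `TC_le_CC`; each
comparison converts a cover with its local data into a cover of the same size for the next
invariant.

From contiguity to fences: a point of `sd^(r+1)(P^n)` is a simplex `σ` of `sd^r(P^n)`. In a
contiguity chain the simplex `Φ l σ ∪ Φ (l+1) σ` contains both `Φ l σ` and `Φ (l+1) σ`, so the chain
yields a fence of simplices of `𝒦(P)` under inclusion. Taking last vertices is monotone and turns it
into a fence in `P`.

From sections to contiguity: this is simplicial approximation. After enough subdivisions the paths
of a section move by less than `1/|P|` over each simplex. At each vertex and each grid time, choose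
a vertex of `𝒦(P)` whose weight in the value of the section is at least `1/|P|` (`heavy`). All
choices made on one simplex lie in the support of the value at its barycentre, which is a simplex
(`heavy_mem_support`, `symContiguous_of_section`). The choice depends on the value alone, so
symmetry is automatic.

From fences to sections: a point `x` of `|𝒦(P)|^n` determines continuous weights on `sd^r(P^n)`
supported on a chain (`sdWeights`). A monotone map to `P` pushes them forward to a point of
`|𝒦(P)|`, and comparable monotone maps have symmetrically homotopic pushforwards
(`Weights.symHomotopic_push_of_le`). Following a fence gives homotopies from a map common to all
branches to the pushforwards of the coordinates of `τ^r`. The `j`-th of these lies in a common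
simplex with `x j`, so a segment finishes the path. -/

theorem leastNat_le {p : ℕ → Prop} {k : ℕ} (h : p k) : leastNat p ≤ k :=
  iInf₂_le k h

theorem le_leastNat {p : ℕ → Prop} {a : ℕ∞} (h : ∀ k, p k → a ≤ k) : a ≤ leastNat p :=
  le_iInf₂ h

theorem img_congr {V W : Type u} {f g : V → W} {s : Finset V} (h : ∀ v ∈ s, f v = g v) :
    img f s = img g s := by
  ext w
  simp only [mem_img]
  exact exists_congr fun v => and_congr_right fun hv => by rw [h v hv]

theorem img_injective {V W : Type u} {f : V → W} (hf : Function.Injective f) :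
    Function.Injective (img f) :=
  @Finset.image_injective V W (Classical.decEq W) f hf

theorem last_eq {Q : Type u} [PartialOrder Q] {s : Finset Q} (hne : s.Nonempty)
    (hs : IsChain (· ≤ ·) (s : Set Q)) {v : Q} (hv : v ∈ s) (hmax : ∀ w ∈ s, w ≤ v) :
    last s hne hs = v :=
  le_antisymm (hmax _ (last_mem s hne hs)) (le_last s hne hs hv)

theorem last_mono {Q : Type u} [PartialOrder Q] {s t : Finset Q} (hs : s.Nonempty)
    (hs' : IsChain (· ≤ ·) (s : Set Q)) (ht : t.Nonempty) (ht' : IsChain (· ≤ ·) (t : Set Q))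
    (h : s ⊆ t) : last s hs hs' ≤ last t ht ht' :=
  le_last t ht ht' (h (last_mem s hs hs'))

theorem last_congr {Q : Type u} [PartialOrder Q] {s t : Finset Q} (hs : s.Nonempty)
    (hs' : IsChain (· ≤ ·) (s : Set Q)) (ht : t.Nonempty) (ht' : IsChain (· ≤ ·) (t : Set Q))
    (h : s = t) : last s hs hs' = last t ht ht' := by
  subst h; rfl

theorem last_img {Q R : Type u} [PartialOrder Q] [PartialOrder R] {f : Q → R} (hf : Monotone f)
    {s : Finset Q} (hs : s.Nonempty) (hs' : IsChain (· ≤ ·) (s : Set Q)) (ht : (img f s).Nonempty)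
    (ht' : IsChain (· ≤ ·) (img f s : Set R)) :
    last (img f s) ht ht' = f (last s hs hs') := by
  refine last_eq _ _ ((mem_img _ _ _).2 ⟨_, last_mem s hs hs', rfl⟩) fun w hw => ?_
  obtain ⟨v, hv, rfl⟩ := (mem_img _ _ _).1 hw
  exact hf (le_last s hs hs' hv)

/-! ### Comparison of the subdivisions of `P^n` and of `𝒦(P)^n` -/

section Comparison

variable (P : Type u) [PartialOrder P] (n : ℕ)

/-- The projections of a chain in `P^n` are chains, so the extra condition on simplices of a power
is automatic for an order complex. Hence `sd^r(𝒦(P)^n)` is itself the order complex of its ordered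
vertex set. -/
theorem faces_pow_sdIter (r : ℕ) (s : Finset (((OrdComplex.ofPoset P).pow n).sdIter r).V) :
    s ∈ (((OrdComplex.ofPoset P).pow n).sdIter r).cpx.faces ↔
      s.Nonempty ∧ IsChain (· ≤ ·) (s : Set (((OrdComplex.ofPoset P).pow n).sdIter r).V) := by
  cases r with
  | zero =>
    constructor
    · exact fun h => ⟨h.1, h.2.1⟩
    · exact fun h => ⟨h.1, h.2, fun j => ⟨img_nonempty _ h.1,
        img_isChain (fun x : Fin n → P => x j) (fun x y (h : x ≤ y) => h j) h.2⟩⟩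
  | succ r => exact Iff.rfl

/-- The comparison of `sd^r(P^n)` with the vertices of `sd^r(𝒦(P)^n)`. -/
def sdIterHom : ∀ r : ℕ, sdIter (powPoset P n) r →o (((OrdComplex.ofPoset P).pow n).sdIter r).V
  | 0 => ⟨fun x => x, fun _ _ h => h⟩
  | r + 1 =>
    { toFun := fun s => (⟨img (sdIterHom r) s.1, (faces_pow_sdIter P n r _).2
        ⟨img_nonempty _ s.2.1, img_isChain _ (sdIterHom r).monotone s.2.2⟩⟩ :
          FacePoset (((OrdComplex.ofPoset P).pow n).sdIter r).cpx)
      monotone' := fun _ _ h => img_mono _ h }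

theorem img_sdIterHom_mem (r : ℕ) (x : sdIter (powPoset P n) (r + 1)) :
    img (sdIterHom P n r) x.1 ∈ (((OrdComplex.ofPoset P).pow n).sdIter r).cpx.faces :=
  (faces_pow_sdIter P n r _).2
    ⟨img_nonempty _ x.2.1, img_isChain _ (sdIterHom P n r).monotone x.2.2⟩

theorem sdIterHom_sdAct (g : Equiv.Perm (Fin n)) (r : ℕ) (x : sdIter (powPoset P n) r) :
    sdIterHom P n r (sdAct P r g x) = (OrdComplex.ofPoset P).sdAct r g (sdIterHom P n r x) := by
  induction r with
  | zero => rfl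
  | succ r ih =>
    refine Subtype.ext ?_
    change img (sdIterHom P n r) (img (sdAct P r g) x.1) =
      img ((OrdComplex.ofPoset P).sdAct r g) (img (sdIterHom P n r) x.1)
    rw [img_img, img_img]
    exact img_congr fun v _ => ih v

theorem iotaIter_sdIterHom (r : ℕ) (x : sdIter (powPoset P n) r) :
    ((OrdComplex.ofPoset P).pow n).iotaIter r (sdIterHom P n r x) =
      tauIter (powPoset P n) r x := by
  induction r with
  | zero => rfl
  | succ r ih =>
    refine Eq.trans (congrArg (((OrdComplex.ofPoset P).pow n).iotaIter r) ?_)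
      (ih (last x.1 x.2.1 x.2.2))
    exact last_img (sdIterHom P n r).monotone x.2.1 x.2.2 (img_nonempty _ x.2.1)
      (img_isChain _ (sdIterHom P n r).monotone x.2.2)

theorem proj_sdIterHom (r : ℕ) (j : Fin n) (x : sdIter (powPoset P n) r) :
    (OrdComplex.ofPoset P).proj r j (sdIterHom P n r x) =
      (tauIter (powPoset P n) r x : Fin n → P) j :=
  congrFun (iotaIter_sdIterHom P n r x) j

end Comparison

/-! ### From contiguity to fences -/

theorem Fence.perm_mk {n m : ℕ} (g : Equiv.Perm (Fin n)) (t : ℕ) (ht : t ≤ m) (j : Fin n) :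
    Fence.perm g (Fence.mk t ht j : Fence n m) = Fence.mk t ht (g j) := by
  cases t <;> rfl

theorem Fence.exists_mk {n m : ℕ} (a : Fence n m) :
    a = .zero ∨ ∃ (t : ℕ) (ht : t ≤ m) (j : Fin n), a = Fence.mk t ht j := by
  cases a with
  | zero => exact Or.inl rfl
  | pt t j => exact Or.inr ⟨t + 1, t.2, j, rfl⟩

open scoped Classical in
/-- The simplices whose last vertices form the fence of a contiguity chain `Φ`: at an even point
`2l` the image of `Φ l`, at an odd point `2l + 1` the union of the images of `Φ l` and
`Φ (l + 1)`. -/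
def fenceFace {n m : ℕ} {W P : Type u} (φs : W → P) (Φ : ℕ → Fin n → W → P) (s : Finset W) :
    Fence n m → Finset P
  | .zero => img φs s
  | .pt t j => img (Φ ((t + 1) / 2) j) s ∪ img (Φ ((t + 2) / 2) j) s

open scoped Classical in
-- The hypothesis `h` says that all branches start with `φs`; this is what makes the uniform formula
-- valid at the shared origin, where `t = 0`.
theorem fenceFace_mk {n m : ℕ} {W P : Type u} {φs : W → P} {Φ : ℕ → Fin n → W → P} {s : Finset W}
    (h : ∀ j, ∀ v ∈ s, Φ 0 j v = φs v) (t : ℕ) (ht : t ≤ m) (j : Fin n) :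
    fenceFace φs Φ s (Fence.mk t ht j : Fence n m) =
      img (Φ (t / 2) j) s ∪ img (Φ ((t + 1) / 2) j) s := by
  cases t with
  | zero =>
    change img φs s = img (Φ 0 j) s ∪ img (Φ 0 j) s
    rw [Finset.union_idempotent, img_congr (h j)]
  | succ t => rfl

/-- An even point `2l` carries the image of `Φ l`, which is one of the two sets united at each of
the odd neighbours `2l - 1` and `2l + 1`. -/
theorem fenceFace_mono {n m : ℕ} {W P : Type u} {φs : W → P} {Φ : ℕ → Fin n → W → P}
    {s : Finset W} (h : ∀ j, ∀ v ∈ s, Φ 0 j v = φs v) {a b : Fence n m} (hab : a ≤ b) :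
    fenceFace φs Φ s a ⊆ fenceFace φs Φ s b := by
  classical
  rcases hab with rfl | ⟨t, u, ht, hu, j, rfl, rfl, ⟨l, rfl⟩, -, htu⟩
  · exact subset_rfl
  · rw [fenceFace_mk h, fenceFace_mk h]
    have h₁ : (l + l) / 2 = l := by omega
    have h₂ : (l + l + 1) / 2 = l := by omega
    rw [h₁, h₂, Finset.union_idempotent]
    rcases htu with rfl | hlu
    · rw [h₂]; exact Finset.subset_union_left
    · have h₃ : (u + 1) / 2 = l := by omega
      rw [h₃]; exact Finset.subset_union_right

theorem fenceFace_subset {n m : ℕ} {W P : Type u} {φs : W → P} {Φ : ℕ → Fin n → W → P}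
    {s t : Finset W} (h : s ⊆ t) (a : Fence n m) : fenceFace φs Φ s a ⊆ fenceFace φs Φ t a := by
  classical
  cases a with
  | zero => exact img_mono _ h
  | pt t j => exact Finset.union_subset_union (img_mono _ h) (img_mono _ h)

theorem CC_le_SC (P : Type u) [PartialOrder P] (n : ℕ) (hn : 2 ≤ n) :
    CC n P ≤ SC n (OrdComplex.ofPoset P) := by
  classical
  refine le_iInf fun r => le_leastNat fun k ⟨L, _, hLinv, hLcov, hL⟩ => ?_
  replace hL : ∀ i, SymContiguous (V := P) (fun g => (OrdComplex.ofPoset P).sdAct r g) (L i)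
      (orderComplex P) (fun j => (OrdComplex.ofPoset P).proj r j) := hL
  choose φs c Φ _ hface h0 hlast hcontig hs_inv hΦ_inv using hL
  set C := Finset.univ.sup c
  have hcC : ∀ i, c i ≤ C := fun i => Finset.le_sup (Finset.mem_univ i)
  -- One more subdivision makes whole simplices of `sd^r` into points. The length `2 * C` is even,
  -- so the fence ends on the image of a single member of the chain, which is the projection.
  refine (iInf_le _ (r + 1)).trans ((iInf_le _ (2 * C)).trans (leastNat_le ?_))
  let D := sdIterHom P n r
  -- The chains have different lengths `c i`; each one is kept constant after its end so that a
  -- single `C` serves them all.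
  let Ψ : Fin k → ℕ → Fin n → _ → P := fun i l => Φ i (min l (c i))
  have vert : ∀ i, ∀ s ∈ (L i).faces, ∀ v ∈ s, {v} ∈ (L i).faces := fun i s hs v hv =>
    ((L i).isRelLowerSet_faces hs).2 (Finset.singleton_subset_iff.2 hv)
      (Finset.singleton_nonempty v)
  have hΨ0 : ∀ i, ∀ s ∈ (L i).faces, ∀ j, ∀ v ∈ s, Ψ i 0 j v = φs i v := by
    intro i s hs j v hv
    simp only [Ψ, Nat.zero_min]
    exact h0 i j v (vert i s hs v hv)
  have hΨu : ∀ i l j, ∀ s ∈ (L i).faces,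
      img (Ψ i l j) s ∪ img (Ψ i (l + 1) j) s ∈ (orderComplex P).faces := by
    intro i l j s hs
    by_cases hl : l < c i
    · have := hcontig i l hl j s hs
      rwa [show Ψ i l = Φ i l by simp only [Ψ, min_eq_left hl.le],
        show Ψ i (l + 1) = Φ i (l + 1) by simp only [Ψ, min_eq_left (Nat.succ_le_of_lt hl)]]
    · have hl := not_lt.1 hl
      simp only [Ψ, min_eq_right hl, min_eq_right (hl.trans (Nat.le_add_right l 1)),
        Finset.union_idempotent]
      exact hface i (c i) le_rfl j s hs
  have hmem : ∀ i, ∀ s ∈ (L i).faces, ∀ a : Fence n (2 * C),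
      fenceFace (φs i) (Ψ i) s a ∈ (orderComplex P).faces := by
    have key : ∀ i, ∀ s ∈ (L i).faces, ∀ (t : ℕ) (ht : t ≤ 2 * C) (j : Fin n),
        fenceFace (φs i) (Ψ i) s (Fence.mk t ht j) ∈ (orderComplex P).faces := by
      intro i s hs t ht j
      rw [fenceFace_mk (hΨ0 i s hs)]
      rcases Nat.even_or_odd' t with ⟨l, rfl | rfl⟩
      · have h₁ : 2 * l / 2 = l := by omega
        have h₂ : (2 * l + 1) / 2 = l := by omega
        rw [h₁, h₂, Finset.union_idempotent]
        exact hface i _ (min_le_right _ _) j s hs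
      · have h₁ : (2 * l + 1) / 2 = l := by omega
        have h₂ : (2 * l + 1 + 1) / 2 = l + 1 := by omega
        rw [h₁, h₂]
        exact hΨu i l j s hs
    intro i s hs a
    rcases a.exists_mk with rfl | ⟨t, ht, j, rfl⟩
    · exact key i s hs 0 (Nat.zero_le _) ⟨0, by omega⟩
    · exact key i s hs t ht j
  -- These sets are lower sets because a subcomplex is closed under passing to faces.
  refine ⟨fun i => {x | img D x.1 ∈ (L i).faces}, ?_, ?_, ?_, ?_⟩
  · intro i x y hyx hx
    exact ((L i).isRelLowerSet_faces hx).2 (img_mono _ hyx) (img_nonempty _ y.2.1)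
  · intro i g x hx
    have h := hLinv i g _ hx
    rw [img_img] at h
    change img D (img (sdAct P r g) x.1) ∈ (L i).faces
    rw [img_img]
    exact (img_congr fun v _ => (sdIterHom_sdAct P n g r v).symm) ▸ h
  · exact fun x => hLcov _ (img_sdIterHom_mem P n r x)
  · intro i
    refine ⟨fun x =>
      { toFun := fun a => last (fenceFace (φs i) (Ψ i) (img D x.1.1) a)
          (hmem i _ x.2 a).1 (hmem i _ x.2 a).2
        monotone' := fun a b hab => last_mono _ _ _ _ (fenceFace_mono (hΨ0 i _ x.2) hab) },
      ?_, ?_, ?_⟩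
    · intro x y hxy a
      exact last_mono (hmem i _ x.2 a).1 (hmem i _ x.2 a).2 (hmem i _ y.2 a).1 (hmem i _ y.2 a).2
        (fenceFace_subset (img_mono _ hxy) a)
    · intro g x y hy a
      refine last_congr (hmem i _ y.2 a).1 (hmem i _ y.2 a).2 (hmem i _ x.2 (Fence.perm g a)).1
        (hmem i _ x.2 (Fence.perm g a)).2 ?_
      have hyD : img D y.1.1 = img ((OrdComplex.ofPoset P).sdAct r g) (img D x.1.1) := by
        rw [hy]
        change img D (img (sdAct P r g) x.1.1) = _
        rw [img_img, img_img]
        exact img_congr fun v _ => sdIterHom_sdAct P n g r v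
      rw [hyD]
      rcases a with _ | ⟨t, j⟩
      · change img _ (img _ _) = img _ _
        rw [img_img]
        exact img_congr fun v hv => hs_inv i g v (vert i _ x.2 v hv)
      · change img _ (img _ _) ∪ img _ (img _ _) = img _ _ ∪ img _ _
        simp only [img_img _ ((OrdComplex.ofPoset P).sdAct r g)]
        have hg : ∀ l, img (fun v => Ψ i l j ((OrdComplex.ofPoset P).sdAct r g v)) (img D x.1.1) =
            img (Ψ i l (g j)) (img D x.1.1) := fun l => img_congr fun v hv =>
          hΦ_inv i _ (min_le_right l (c i)) j g v (vert i _ x.2 v hv)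
        exact congrArg₂ (fun s t : Finset P => s ∪ t) (hg ((t + 1) / 2)) (hg ((t + 2) / 2))
    · intro x
      funext j
      have hm := hmem i _ x.2 (Fence.mk (2 * C) le_rfl j)
      change last (fenceFace (φs i) (Ψ i) (img D x.1.1) (Fence.mk (2 * C) le_rfl j)) hm.1 hm.2 =
        (tauIter (powPoset P n) r (last x.1.1 x.1.2.1 x.1.2.2) : Fin n → P) j
      -- The end face of the fence is the image of the chain under `π`. As `π` is monotone, the last
      -- vertex of this image is the value of `π` at the last element of the chain.
      let π : sdIter (powPoset P n) r → P := fun v => (tauIter (powPoset P n) r v : Fin n → P) j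
      have hπ : Monotone π := fun v w h => (tauIter (powPoset P n) r).monotone h j
      have hS : fenceFace (φs i) (Ψ i) (img D x.1.1) (Fence.mk (2 * C) le_rfl j) =
          img π x.1.1 := by
        have h₁ : 2 * C / 2 = C := by omega
        have h₂ : (2 * C + 1) / 2 = C := by omega
        rw [fenceFace_mk (hΨ0 i _ x.2), h₁, h₂, Finset.union_idempotent, img_img]
        refine img_congr fun v hv => ?_
        simp only [Ψ, min_eq_right (hcC i)]
        rw [hlast i j _ (vert i _ x.2 _ ((mem_img _ _ _).2 ⟨v, hv, rfl⟩))]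
        exact proj_sdIterHom P n r j v
      rw [last_congr hm.1 hm.2 (img_nonempty π x.1.2.1) (img_isChain π hπ x.1.2.2) hS]
      exact last_img hπ x.1.2.1 x.1.2.2 _ _

/-! ### The geometric realization of an order complex -/

/-- The geometric realization of the order complex of `P`. -/
abbrev Polyhedron (P : Type u) [PartialOrder P] [Fintype P] : Type u :=
  realization (orderComplex P)

theorem support_nonempty_of_mem_stdSimplex {P : Type*} [Fintype P] {α : P → ℝ}
    (h : α ∈ stdSimplex ℝ P) : (Function.support α).Nonempty := by
  by_contra hne
  rw [Set.not_nonempty_iff_eq_empty, Function.support_eq_empty_iff] at hne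
  have := h.2
  simp [hne] at this

section Polyhedron

variable {P : Type u} [PartialOrder P] [Fintype P]

theorem mem_realization_iff {α : P → ℝ} :
    α ∈ realization (orderComplex P) ↔
      α ∈ stdSimplex ℝ P ∧ IsChain (· ≤ ·) (Function.support α) := by
  constructor
  · rintro ⟨h, s, hs, hsα⟩
    exact ⟨h, hsα ▸ hs.2⟩
  · rintro ⟨h, hc⟩
    refine ⟨h, (Set.toFinite (Function.support α)).toFinset, ⟨?_, ?_⟩, by simp⟩
    · simpa using support_nonempty_of_mem_stdSimplex h
    · simpa using hc

/-- The realization is a finite union, over the chains `s`, of the closed faces of the standard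
simplex on which all coordinates outside `s` vanish. -/
theorem isCompact_realization : IsCompact (realization (orderComplex P)) := by
  have h : realization (orderComplex P) =
      ⋃ s ∈ {s : Set P | IsChain (· ≤ ·) s}, stdSimplex ℝ P ∩ ⋂ p ∈ sᶜ, {α | α p = 0} := by
    ext α
    rw [mem_realization_iff]
    simp only [Set.mem_ofPred_eq, Set.mem_iUnion, exists_prop, Set.mem_inter_iff, Set.mem_iInter,
      Set.mem_compl_iff]
    constructor
    · rintro ⟨h, hc⟩
      exact ⟨_, hc, h, fun p hp => by simpa using hp⟩
    · rintro ⟨s, hs, h, h0⟩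
      exact ⟨h, hs.mono fun p hp => by_contra fun hps => hp (h0 p hps)⟩
  rw [h]
  refine (Set.toFinite _).isCompact_biUnion fun s _ => ?_
  exact (isCompact_stdSimplex ℝ P).inter_right <| isClosed_iInter fun p =>
    isClosed_iInter fun _ => isClosed_eq (continuous_apply p) continuous_const

instance : CompactSpace (Polyhedron P) :=
  isCompact_iff_compactSpace.1 isCompact_realization

theorem exists_heavy (α : Polyhedron P) : ∃ p, (Fintype.card P : ℝ)⁻¹ ≤ α.1 p := by
  obtain ⟨p₀, -⟩ := support_nonempty_of_mem_stdSimplex α.2.1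
  have : Nonempty P := ⟨p₀⟩
  obtain ⟨p, -, hp⟩ := Finset.exists_le_of_sum_le (s := Finset.univ)
    (f := fun _ : P => (Fintype.card P : ℝ)⁻¹) (g := α.1) Finset.univ_nonempty (by
      rw [α.2.1.2]
      simp)
  exact ⟨p, hp⟩

/-- A vertex of large weight. -/
def heavy (α : Polyhedron P) : P := (exists_heavy α).choose

theorem le_heavy (α : Polyhedron P) : (Fintype.card P : ℝ)⁻¹ ≤ α.1 (heavy α) :=
  (exists_heavy α).choose_spec

/-- In the sup metric a coordinate of size at least `1/|P|` cannot reach zero under a move of less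
than `1/|P|`. This plays the role of open stars in simplicial approximation. -/
theorem heavy_mem_support {α β : Polyhedron P} (h : dist α β < (Fintype.card P : ℝ)⁻¹) :
    heavy α ∈ Function.support β.1 := by
  have h₁ : dist (α.1 (heavy α)) (β.1 (heavy α)) < (Fintype.card P : ℝ)⁻¹ :=
    (dist_le_pi_dist α.1 β.1 _).trans_lt h
  have h₂ := le_heavy α
  rw [Real.dist_eq] at h₁
  have h₃ := (abs_lt.1 h₁).2
  exact ne_of_gt (by linarith)

theorem faces_of_subset_support (α : Polyhedron P) {s : Finset P} (hs : s.Nonempty)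
    (h : ∀ p ∈ s, p ∈ Function.support α.1) : s ∈ (orderComplex P).faces :=
  ⟨hs, (mem_realization_iff.1 α.2).2.mono h⟩

end Polyhedron

/-! ### Averages -/

section Average

variable {V : Type*} {E : Type*}

/-- The average of `f` over a finite set. -/
def average [AddCommGroup E] [Module ℝ E] (f : V → E) (s : Finset V) : E :=
  (s.card : ℝ)⁻¹ • ∑ v ∈ s, f v

theorem average_singleton [AddCommGroup E] [Module ℝ E] (f : V → E) (v : V) :
    average f {v} = f v := by
  simp [average]

theorem average_mem [AddCommGroup E] [Module ℝ E] {f : V → E} {s : Finset V} (hs : s.Nonempty)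
    {C : Set E} (hC : Convex ℝ C) (h : ∀ v ∈ s, f v ∈ C) : average f s ∈ C := by
  have hs' : (s.card : ℝ) ≠ 0 := Nat.cast_ne_zero.2 hs.card_pos.ne'
  rw [average, Finset.smul_sum]
  refine hC.sum_mem (fun _ _ => by positivity) ?_ h
  rw [Finset.sum_const, nsmul_eq_mul, mul_inv_cancel₀ hs']

theorem dist_average_le [NormedAddCommGroup E] [NormedSpace ℝ E] {f : V → E} {s : Finset V}
    (hs : s.Nonempty) {x : E} {D : ℝ} (h : ∀ v ∈ s, dist (f v) x ≤ D) :
    dist (average f s) x ≤ D :=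
  average_mem hs (convex_closedBall x D) h

/-- The deviations from the average over `s` cancel on `s`, so the two averages differ by `1/|t|`
times a sum over `t \ s`. That sum has at most `|t| - 1` terms, each of norm at most `D`. -/
theorem dist_average_average_le [NormedAddCommGroup E] [NormedSpace ℝ E] {f : V → E}
    {s t : Finset V} (hs : s.Nonempty) (hst : s ⊆ t) {D : ℝ}
    (h : ∀ v ∈ t, ∀ w ∈ t, dist (f v) (f w) ≤ D) :
    dist (average f s) (average f t) ≤ (1 - (t.card : ℝ)⁻¹) * D := by
  classical
  have hs0 : (s.card : ℝ) ≠ 0 := Nat.cast_ne_zero.2 hs.card_pos.ne'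
  have ht : 0 < (t.card : ℝ) := Nat.cast_pos.2 (hs.mono hst).card_pos
  obtain ⟨v₀, hv₀⟩ := hs
  have hD : 0 ≤ D := dist_nonneg.trans (h v₀ (hst hv₀) v₀ (hst hv₀))
  have h₁ : ∑ v ∈ s, (f v - average f s) = 0 := by
    rw [Finset.sum_sub_distrib, Finset.sum_const, average, ← Nat.cast_smul_eq_nsmul ℝ, smul_smul,
      mul_inv_cancel₀ hs0, one_smul, sub_self]
  have h₂ : average f t - average f s = (t.card : ℝ)⁻¹ • ∑ v ∈ t \ s, (f v - average f s) := by
    have h₃ : ∑ v ∈ t \ s, (f v - average f s) = ∑ v ∈ t, (f v - average f s) := by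
      rw [← Finset.sum_sdiff hst, h₁, add_zero]
    rw [h₃, Finset.sum_sub_distrib, Finset.sum_const, ← Nat.cast_smul_eq_nsmul ℝ, smul_sub,
      smul_smul, inv_mul_cancel₀ ht.ne', one_smul]
    rfl
  rw [dist_comm, dist_eq_norm, h₂, norm_smul, Real.norm_of_nonneg (by positivity)]
  have h₄ : ‖∑ v ∈ t \ s, (f v - average f s)‖ ≤ ((t \ s).card : ℝ) * D := by
    rw [← nsmul_eq_mul]
    refine norm_sum_le_of_le _ (fun v hv => ?_) |>.trans_eq (Finset.sum_const D)
    rw [← dist_eq_norm, dist_comm]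
    exact dist_average_le ⟨v₀, hv₀⟩ fun w hw => h w (hst hw) v (Finset.mem_sdiff.1 hv).1
  have h₅ : ((t \ s).card : ℝ) ≤ t.card - 1 := by
    rw [Finset.cast_card_sdiff hst]
    have : (1 : ℝ) ≤ s.card := Nat.one_le_cast.2 (Finset.card_pos.2 ⟨v₀, hv₀⟩)
    linarith
  calc (t.card : ℝ)⁻¹ * ‖∑ v ∈ t \ s, (f v - average f s)‖
      ≤ (t.card : ℝ)⁻¹ * ((t.card - 1) * D) := by gcongr; exact h₄.trans (by gcongr)
    _ = (1 - (t.card : ℝ)⁻¹) * D := by field_simp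

end Average

theorem average_img {U V : Type u} {E : Type*} [AddCommGroup E] [Module ℝ E] (f : V → E)
    {g : U → V} (hg : Function.Injective g) (s : Finset U) :
    average f (img g s) = average (fun u => f (g u)) s := by
  classical
  have h : img g s = s.map ⟨g, hg⟩ := by
    ext; simp [mem_img]
  rw [h, average, average, Finset.card_map, Finset.sum_map]
  rfl

/-! ### Barycentres -/

/-- The factor by which a subdivision shrinks the simplices. -/
def shrink (P : Type*) (n : ℕ) : ℝ := 1 - (Nat.card (Fin n → P) + 1 : ℝ)⁻¹

theorem shrink_nonneg (P : Type*) (n : ℕ) : 0 ≤ shrink P n := by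
  rw [shrink, sub_nonneg]
  exact inv_le_one_of_one_le₀ (by linarith [(Nat.card (Fin n → P)).cast_nonneg (α := ℝ)])

/-- The `+ 1` in `shrink` keeps the factor below `1` even when `Nat.card (Fin n → P)` is zero, where
the inverse would otherwise take the default value `0`. -/
theorem shrink_lt_one (P : Type*) (n : ℕ) : shrink P n < 1 := by
  rw [shrink]
  have : (0 : ℝ) < (Nat.card (Fin n → P) + 1 : ℝ)⁻¹ := by positivity
  linarith

section Barycentre

variable (P : Type u) [PartialOrder P] (n : ℕ)

/-- The vertices of `sd^r(𝒦(P)^n)`. -/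
abbrev SdVertex (r : ℕ) : Type u := (((OrdComplex.ofPoset P).pow n).sdIter r).V

/-- The simplices of `sd^r(𝒦(P)^n)`. -/
abbrev sdFaces (r : ℕ) : Set (Finset (SdVertex P n r)) :=
  (((OrdComplex.ofPoset P).pow n).sdIter r).cpx.faces

/-- The action on the vertices of `sd^r(𝒦(P)^n)`. -/
abbrev vertexAct (r : ℕ) (g : Equiv.Perm (Fin n)) : SdVertex P n r → SdVertex P n r :=
  (OrdComplex.ofPoset P).sdAct r g

open scoped Classical in
/-- The position of a vertex of `sd^r(𝒦(P)^n)` in the `n`-th power of the realization of `𝒦(P)`. -/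
def position : ∀ r : ℕ, SdVertex P n r → Fin n → P → ℝ
  | 0 => fun x j => Pi.single ((x : Fin n → P) j) 1
  | r + 1 => fun s => average (position r)
      (s : FacePoset (((OrdComplex.ofPoset P).pow n).sdIter r).cpx).1

open scoped Classical in
theorem position_zero (x : Fin n → P) (j : Fin n) :
    position P n 0 x j = (Pi.single (x j) 1 : P → ℝ) := rfl

theorem position_succ (r : ℕ) (s : Finset (SdVertex P n r)) (hs : s ∈ sdFaces P n r) :
    position P n (r + 1) (⟨s, hs⟩ : FacePoset (((OrdComplex.ofPoset P).pow n).sdIter r).cpx) =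
      average (position P n r) s := rfl

theorem sdIterMap_injective {K L : OrdComplex.{u}} (f : SimplicialMap K L)
    (hf : Function.Injective f.toFun) (r : ℕ) :
    Function.Injective (OrdComplex.sdIterMap f r).toFun := by
  induction r with
  | zero => exact hf
  | succ r ih => exact fun s t h => Subtype.ext (img_injective ih (Subtype.ext_iff.1 h))

theorem vertexAct_injective (r : ℕ) (g : Equiv.Perm (Fin n)) :
    Function.Injective (vertexAct P n r g) := by
  refine sdIterMap_injective _ (fun x y h => ?_) r
  funext j
  have := congrFun h (g.symm j)
  simpa [OrdComplex.perm] using this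

theorem vertexAct_monotone (r : ℕ) (g : Equiv.Perm (Fin n)) : Monotone (vertexAct P n r g) := by
  cases r with
  | zero => exact fun x y h j => h (g j)
  | succ r => exact fun s t h => img_mono _ h

theorem proj_act (r : ℕ) (g : Equiv.Perm (Fin n)) (v : SdVertex P n r) (j : Fin n) :
    (OrdComplex.ofPoset P).proj r j (vertexAct P n r g v) =
      (OrdComplex.ofPoset P).proj r (g j) v := by
  induction r with
  | zero => rfl
  | succ r ih =>
    obtain ⟨s, hs⟩ := v
    have hs' := (((OrdComplex.ofPoset P).pow n).sdIter r).isChain s hs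
    have hne := ((((OrdComplex.ofPoset P).pow n).sdIter r).cpx.isRelLowerSet_faces hs).1
    refine Eq.trans (congrArg ((OrdComplex.ofPoset P).proj r j) ?_) (ih (last s hne hs'))
    exact last_img (vertexAct_monotone P n r g) hne hs' (img_nonempty _ hne)
      (img_isChain _ (vertexAct_monotone P n r g) hs')

theorem position_act (r : ℕ) (g : Equiv.Perm (Fin n)) (v : SdVertex P n r) (j : Fin n) :
    position P n r (vertexAct P n r g v) j = position P n r v (g j) := by
  induction r with
  | zero => rfl
  | succ r ih =>
    obtain ⟨s, hs⟩ := v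
    have h : position P n (r + 1) (vertexAct P n (r + 1) g
        (⟨s, hs⟩ : FacePoset (((OrdComplex.ofPoset P).pow n).sdIter r).cpx)) =
        average (position P n r) (img (vertexAct P n r g) s) := rfl
    rw [h, average_img _ (vertexAct_injective P n r g), position_succ]
    simp only [average, Pi.smul_apply, Finset.sum_apply, ih]

theorem sdFaces_subset {r : ℕ} {s t : Finset (SdVertex P n r)} (hs : s ∈ sdFaces P n r)
    (hts : t ⊆ s) (ht : t.Nonempty) : t ∈ sdFaces P n r :=
  ((((OrdComplex.ofPoset P).pow n).sdIter r).cpx.isRelLowerSet_faces hs).2 hts ht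

theorem sdFaces_nonempty {r : ℕ} {s : Finset (SdVertex P n r)} (hs : s ∈ sdFaces P n r) :
    s.Nonempty :=
  ((((OrdComplex.ofPoset P).pow n).sdIter r).cpx.isRelLowerSet_faces hs).1

/-- The simplices in a chain have distinct cardinalities, all between `1` and the previous bound, so
subdivision does not enlarge the bound. A single contraction factor then works for all `r`. -/
theorem card_le_of_mem_sdFaces [Fintype P] (r : ℕ) (s : Finset (SdVertex P n r))
    (hs : s ∈ sdFaces P n r) : s.card ≤ Nat.card (Fin n → P) := by
  induction r with
  | zero =>
    rw [Nat.card_eq_fintype_card]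
    have h : ∀ s : Finset (Fin n → P), s.card ≤ Fintype.card (Fin n → P) := Finset.card_le_univ
    exact h s
  | succ r ih =>
    change Finset (FacePoset (((OrdComplex.ofPoset P).pow n).sdIter r).cpx) at s
    have hinj : Set.InjOn (fun σ : FacePoset (((OrdComplex.ofPoset P).pow n).sdIter r).cpx =>
        σ.1.card) (s : Set (FacePoset (((OrdComplex.ofPoset P).pow n).sdIter r).cpx)) := by
      intro σ hσ τ hτ h
      rcases hs.2.total hσ hτ with h' | h'
      · exact Subtype.ext (Finset.eq_of_subset_of_card_le h' (le_of_eq h.symm))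
      · exact Subtype.ext (Finset.eq_of_subset_of_card_le h' (le_of_eq h)).symm
    have := Finset.card_le_card_of_injOn
      (s := s)
      (t := Finset.Icc 1 (Nat.card (Fin n → P))) _ (fun σ _ => Finset.mem_coe.2
        (Finset.mem_Icc.2 ⟨(sdFaces_nonempty P n σ.2).card_pos, ih σ.1 σ.2⟩)) hinj
    rwa [Nat.card_Icc, Nat.add_sub_cancel] at this

variable [Fintype P]

theorem position_mem_stdSimplex (r : ℕ) (v : SdVertex P n r) (j : Fin n) :
    position P n r v j ∈ stdSimplex ℝ P := by
  induction r with
  | zero =>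
    classical
    have h : ∀ v : Fin n → P, position P n 0 v j ∈ stdSimplex ℝ P := by
      intro v
      rw [position_zero]
      convert single_mem_stdSimplex ℝ (v j)
    exact h v
  | succ r ih =>
    obtain ⟨s, hs⟩ := v
    have h : position P n (r + 1)
        (⟨s, hs⟩ : FacePoset (((OrdComplex.ofPoset P).pow n).sdIter r).cpx) j =
        average (fun v => position P n r v j) s := by
      rw [position_succ]
      simp only [average, Pi.smul_apply, Finset.sum_apply]
    rw [h]
    exact average_mem (sdFaces_nonempty P n hs) (convex_stdSimplex ℝ P) fun v _ => ih v

/-- All coordinates are nonnegative, so nothing cancels in an average. -/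
theorem position_succ_ne_zero_iff (r : ℕ) (s : Finset (SdVertex P n r)) (hs : s ∈ sdFaces P n r)
    (j : Fin n) (p : P) :
    position P n (r + 1) (⟨s, hs⟩ : FacePoset (((OrdComplex.ofPoset P).pow n).sdIter r).cpx) j p ≠ 0
      ↔ ∃ v ∈ s, position P n r v j p ≠ 0 := by
  have hc : (s.card : ℝ)⁻¹ ≠ 0 :=
    inv_ne_zero (Nat.cast_ne_zero.2 (sdFaces_nonempty P n hs).card_pos.ne')
  rw [position_succ]
  simp only [average, Pi.smul_apply, Finset.sum_apply, smul_eq_mul, ne_eq, mul_eq_zero, hc,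
    false_or]
  rw [Finset.sum_eq_zero_iff_of_nonneg fun v _ => (position_mem_stdSimplex P n r v j).1 p]
  push Not
  rfl

/-- In a subdivision every simplex of a chain is contained in the largest one, so all supports
already occur among the vertices of that one simplex. -/
theorem isChain_position (r : ℕ) (s : Finset (SdVertex P n r)) (hs : s ∈ sdFaces P n r)
    (j : Fin n) : IsChain (· ≤ ·) {p | ∃ v ∈ s, position P n r v j p ≠ 0} := by
  induction r with
  | zero =>
    have h : ∀ (v : Fin n → P) (p : P), position P n 0 v j p ≠ 0 → v j = p := by
      classical
      intro v p hp
      by_contra hne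
      exact hp (Pi.single_eq_of_ne (Ne.symm hne) _)
    rintro p ⟨v, hv, hp⟩ q ⟨w, hw, hq⟩ -
    rw [← h v p hp, ← h w q hq]
    exact (hs.2.1.total hv hw).imp (fun h => h j) (fun h => h j)
  | succ r ih =>
    obtain ⟨t, -, hmax⟩ := exists_last
      (s : Finset (FacePoset (((OrdComplex.ofPoset P).pow n).sdIter r).cpx)) hs.1 hs.2
    refine (ih t.1 t.2).mono ?_
    rintro p ⟨σ, hσ, hp⟩
    obtain ⟨v, hv, hvp⟩ := (position_succ_ne_zero_iff P n r σ.1 σ.2 j p).1 hp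
    exact ⟨v, hmax σ hσ hv, hvp⟩

theorem position_proj_ne_zero (r : ℕ) (v : SdVertex P n r) (j : Fin n) :
    position P n r v j ((OrdComplex.ofPoset P).proj r j v) ≠ 0 := by
  induction r with
  | zero =>
    classical
    have h : ∀ v : Fin n → P, position P n 0 v j (v j) ≠ 0 := by
      intro v
      rw [position_zero, Pi.single_eq_same]
      exact one_ne_zero
    exact h v
  | succ r ih =>
    obtain ⟨s, hs⟩ := v
    exact (position_succ_ne_zero_iff P n r s hs j _).2
      ⟨_, last_mem s (sdFaces_nonempty P n hs)
        ((((OrdComplex.ofPoset P).pow n).sdIter r).isChain s hs), ih _⟩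

/-- This is the mesh estimate. Two vertices of a common simplex are nested simplices one level
below, so `dist_average_average_le` gains one factor at each level. -/
theorem dist_position_le (r : ℕ) (s : Finset (SdVertex P n r)) (hs : s ∈ sdFaces P n r)
    (v : SdVertex P n r) (hv : v ∈ s) (w : SdVertex P n r) (hw : w ∈ s) :
    dist (position P n r v) (position P n r w) ≤ shrink P n ^ r := by
  induction r with
  | zero =>
    rw [pow_zero]
    refine (dist_pi_le_iff zero_le_one).2 fun j => (dist_pi_le_iff zero_le_one).2 fun p => ?_
    have h := fun u : SdVertex P n 0 => position_mem_stdSimplex P n 0 u j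
    have h1 := fun u => (h u).1 p
    have h2 := fun u => (mem_Icc_of_mem_stdSimplex (h u) p).2
    rw [Real.dist_eq, abs_le]
    constructor <;> linarith [h1 v, h1 w, h2 v, h2 w]
  | succ r ih =>
    have key : ∀ σ τ : FacePoset (((OrdComplex.ofPoset P).pow n).sdIter r).cpx, σ ≤ τ →
        dist (average (position P n r) σ.1) (average (position P n r) τ.1) ≤
          shrink P n ^ (r + 1) := by
      intro σ τ hστ
      refine (dist_average_average_le (sdFaces_nonempty P n σ.2) hστ
        (fun v hv w hw => ih τ.1 τ.2 v hv w hw)).trans ?_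
      rw [pow_succ']
      refine mul_le_mul_of_nonneg_right ?_ (pow_nonneg (shrink_nonneg P n) r)
      rw [shrink]
      have h₁ : (τ.1.card : ℝ) ≤ Nat.card (Fin n → P) :=
        Nat.cast_le.2 (card_le_of_mem_sdFaces P n r τ.1 τ.2)
      have h₂ : (0 : ℝ) < τ.1.card := Nat.cast_pos.2 (sdFaces_nonempty P n τ.2).card_pos
      gcongr
      linarith
    rcases hs.2.total hv hw with h | h
    · exact key v w h
    · rw [dist_comm]; exact key w v h

/-- The point of the `n`-th power of the realization of `𝒦(P)` at a vertex of `sd^r(𝒦(P)^n)`. -/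
def point (r : ℕ) (v : SdVertex P n r) (j : Fin n) : Polyhedron P :=
  ⟨position P n r v j, mem_realization_iff.2 ⟨position_mem_stdSimplex P n r v j,
    by
    refine (isChain_position P n r {v}
      ((((OrdComplex.ofPoset P).pow n).sdIter r).cpx.singleton_mem v) j).mono ?_
    intro p hp
    exact ⟨v, Finset.mem_singleton_self v, hp⟩⟩⟩

theorem point_act (r : ℕ) (g : Equiv.Perm (Fin n)) (v : SdVertex P n r) :
    point P n r (vertexAct P n r g v) = fun j => point P n r v (g j) :=
  funext fun j => Subtype.ext (position_act P n r g v j)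

/-- The barycentre of a simplex of `sd^r(𝒦(P)^n)`. -/
def barycentre (r : ℕ) (s : sdFaces P n r) : Fin n → Polyhedron P := point P n (r + 1) s

theorem dist_point_barycentre_le (r : ℕ) (s : sdFaces P n r) (v : SdVertex P n r) (hv : v ∈ s.1) :
    dist (point P n r v) (barycentre P n r s) ≤ shrink P n ^ r := by
  rw [dist_comm]
  change dist (average (position P n r) s.1) (position P n r v) ≤ _
  exact dist_average_le (sdFaces_nonempty P n s.2) fun w hw =>
    dist_position_le P n r s.1 s.2 w hw v hv

theorem barycentre_singleton (r : ℕ) (v : SdVertex P n r) (hv : {v} ∈ sdFaces P n r) :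
    barycentre P n r ⟨{v}, hv⟩ = point P n r v :=
  funext fun j => Subtype.ext (congrFun (average_singleton (position P n r) v) j)

theorem barycentre_act (r : ℕ) (g : Equiv.Perm (Fin n)) (s : Finset (SdVertex P n r))
    (hs : s ∈ sdFaces P n r) (hs' : img (vertexAct P n r g) s ∈ sdFaces P n r) :
    barycentre P n r ⟨img (vertexAct P n r g) s, hs'⟩ =
      fun j => barycentre P n r ⟨s, hs⟩ (g j) := by
  refine funext fun j => Subtype.ext ?_
  change average (position P n r) (img (vertexAct P n r g) s) j =
    average (position P n r) s (g j)
  rw [average_img _ (vertexAct_injective P n r g)]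
  simp only [average, Pi.smul_apply, Finset.sum_apply, position_act]

end Barycentre

/-! ### Simplicial approximation of equivariant sections -/

/-- The branch `t ↦ t_j` of the wedge. -/
def Wedge.branch {n : ℕ} (j : Fin n) : C(unitInterval, Wedge n) where
  toFun t := Wedge.mk t j
  continuous_toFun := continuous_quotient_mk'.comp (by fun_prop)

theorem Wedge.mk_zero {n : ℕ} (i j : Fin n) : Wedge.mk 0 i = Wedge.mk 0 j :=
  Quotient.sound (Or.inr ⟨rfl, rfl⟩)

/-- The `l`-th of the points that divide the unit interval into `N` equal parts. -/
def gridPoint (N l : ℕ) : unitInterval := Set.projIcc 0 1 zero_le_one (l / N : ℝ)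

theorem gridPoint_zero (N : ℕ) : gridPoint N 0 = 0 := by
  rw [gridPoint, Nat.cast_zero, zero_div]
  exact Set.projIcc_left _

theorem gridPoint_self {N : ℕ} (hN : N ≠ 0) : gridPoint N N = 1 := by
  rw [gridPoint, div_self (Nat.cast_ne_zero.2 hN)]
  exact Set.projIcc_right _

theorem dist_gridPoint_succ (N l : ℕ) : dist (gridPoint N l) (gridPoint N (l + 1)) ≤ 1 / N := by
  have h : LipschitzWith 1 (Set.projIcc (0 : ℝ) 1 zero_le_one) := LipschitzWith.projIcc _
  refine (h.dist_le_mul _ _).trans ?_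
  rw [NNReal.coe_one, one_mul, Real.dist_eq, ← sub_div, Nat.cast_add, Nat.cast_one,
    sub_add_cancel_left, abs_div, abs_neg, abs_one, Nat.abs_cast]

theorem dist_perm {n : ℕ} {X : Type*} [PseudoMetricSpace X] (g : Equiv.Perm (Fin n))
    (x y : Fin n → X) : dist (fun j => x (g j)) y = dist x (fun j => y (g.symm j)) := by
  have key : ∀ (g : Equiv.Perm (Fin n)) (x y : Fin n → X),
      dist (fun j => x (g j)) (fun j => y (g j)) ≤ dist x y := fun g x y =>
    (dist_pi_le_iff dist_nonneg).2 fun j => dist_le_pi_dist x y (g j)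
  refine le_antisymm ?_ ?_
  · simpa using key g x (fun j => y (g.symm j))
  · simpa using key g.symm (fun j => x (g j)) y

open scoped Classical in
/-- The projections are symmetrically contiguous on a subcomplex whose barycentres lie in a set over
which there is a uniformly continuous equivariant section. -/
theorem symContiguous_of_section {P : Type u} [PartialOrder P] [Fintype P] {n : ℕ} (hn : 2 ≤ n)
    {U : Set (Fin n → Polyhedron P)}
    {G : (Fin n → Polyhedron P) → unitInterval → Fin n → Polyhedron P}
    (hG0 : ∀ x i j, G x 0 i = G x 0 j) (hG1 : ∀ x ∈ U, G x 1 = x)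
    (hGact : ∀ g : Equiv.Perm (Fin n), ∀ x ∈ U, ∀ t j, G (fun j => x (g j)) t j = G x t (g j))
    {η : ℝ} (hη : 0 < η)
    (hGη : ∀ x ∈ U, ∀ y ∈ U, ∀ t t', dist x y < η → dist t t' < η →
      dist (G x t) (G y t') < (Fintype.card P : ℝ)⁻¹)
    {r : ℕ} (hr : shrink P n ^ r < η) (L : PreAbstractSimplicialComplex (SdVertex P n r))
    (hL : L.faces ⊆ sdFaces P n r)
    (hLU : ∀ σ (hσ : σ ∈ L.faces), barycentre P n r ⟨σ, hL hσ⟩ ∈ U) :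
    SymContiguous (vertexAct P n r) L (orderComplex P)
      (fun j => (OrdComplex.ofPoset P).proj r j) := by
  obtain ⟨N, hN⟩ := exists_nat_one_div_lt hη
  have hpt : ∀ v, {v} ∈ L.faces → point P n r v ∈ U := fun v hv =>
    barycentre_singleton P n r v (hL hv) ▸ hLU {v} hv
  have hvert : ∀ σ ∈ L.faces, ∀ v ∈ σ, {v} ∈ L.faces := fun σ hσ v hv =>
    (L.isRelLowerSet_faces hσ).2 (Finset.singleton_subset_iff.2 hv) (Finset.singleton_nonempty v)
  -- All choices on `σ` at times near `t'` fall into the support of one point, the value at the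
  -- barycentre of `σ`.
  have key : ∀ σ (hσ : σ ∈ L.faces), ∀ v ∈ σ, ∀ t t' j, dist t t' < η →
      heavy (G (point P n r v) t j) ∈
        Function.support (G (barycentre P n r ⟨σ, hL hσ⟩) t' j).1 := by
    intro σ hσ v hv t t' j htt
    refine heavy_mem_support ((dist_le_pi_dist _ _ j).trans_lt (hGη _ (hpt v (hvert σ hσ v hv)) _
      (hLU σ hσ) t t' ?_ htt))
    exact (dist_point_barycentre_le P n r ⟨σ, hL hσ⟩ v hv).trans_lt hr
  -- Indices `0, …, N + 1` follow the paths at the grid times `l / (N + 1)`, whose step is less than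
  -- `η`. At time `1` the choice need not be the last vertex, so index `N + 2` makes one further
  -- step to the projection.
  let Φ : ℕ → Fin n → SdVertex P n r → P := fun l j v =>
    if l ≤ N + 1 then heavy (G (point P n r v) (gridPoint (N + 1) l) j)
    else (OrdComplex.ofPoset P).proj r j v
  have hΦ : ∀ l ≤ N + 1, ∀ j v,
      Φ l j v = heavy (G (point P n r v) (gridPoint (N + 1) l) j) :=
    fun l hl j v => if_pos hl
  have hΦlast : ∀ j v, Φ (N + 2) j v = (OrdComplex.ofPoset P).proj r j v :=
    fun j v => if_neg (by omega)
  have hcontig : ∀ l < N + 2, ∀ j, ∀ σ ∈ L.faces,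
      img (Φ l j) σ ∪ img (Φ (l + 1) j) σ ∈ (orderComplex P).faces := by
    intro l hl j σ hσ
    refine faces_of_subset_support (G (barycentre P n r ⟨σ, hL hσ⟩) (gridPoint (N + 1) l) j)
      ((img_nonempty _ (L.isRelLowerSet_faces hσ).1).mono Finset.subset_union_left) ?_
    intro p hp
    rw [Finset.mem_union, mem_img, mem_img] at hp
    rcases hp with ⟨v, hv, rfl⟩ | ⟨v, hv, rfl⟩
    · rw [hΦ l (by omega)]
      exact key σ hσ v hv _ _ j (by rwa [dist_self])
    · rcases (Nat.lt_succ_iff.1 hl).lt_or_eq with hl | rfl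
      · rw [hΦ (l + 1) hl]
        refine key σ hσ v hv _ _ j ?_
        rw [dist_comm]
        refine (dist_gridPoint_succ (N + 1) l).trans_lt ?_
        exact_mod_cast hN
      -- At time `1` the section returns the barycentre itself, whose support contains the
      -- projection of every vertex of `σ`.
      · rw [hΦlast, gridPoint_self (Nat.succ_ne_zero N), hG1 _ (hLU σ hσ)]
        exact (position_succ_ne_zero_iff P n r σ (hL hσ) j _).2
          ⟨v, hv, position_proj_ne_zero P n r v j⟩
  refine ⟨Φ 0 ⟨0, by omega⟩, N + 2, Φ, Nat.succ_pos _, ?_, ?_, fun j v _ => hΦlast j v, hcontig,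
    ?_, ?_⟩
  · intro l hl j σ hσ
    have hne := img_nonempty (Φ l j) (L.isRelLowerSet_faces hσ).1
    rcases hl.lt_or_eq with hl | rfl
    · exact ((orderComplex P).isRelLowerSet_faces (hcontig l hl j σ hσ)).2
        Finset.subset_union_left hne
    · exact ((orderComplex P).isRelLowerSet_faces (hcontig (N + 1) (Nat.lt_succ_self _) j σ hσ)).2
        Finset.subset_union_right hne
  · intro j v _
    rw [hΦ 0 (Nat.zero_le _), hΦ 0 (Nat.zero_le _), gridPoint_zero, hG0]
  · intro g v hv
    rw [hΦ 0 (Nat.zero_le _), hΦ 0 (Nat.zero_le _), gridPoint_zero, point_act,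
      hGact g _ (hpt v hv), hG0]
  · intro l hl j g v hv
    rcases hl.lt_or_eq with hl | rfl
    · rw [hΦ l (by omega), hΦ l (by omega), point_act, hGact g _ (hpt v hv)]
    · rw [hΦlast, hΦlast, proj_act]

theorem SC_le_TC (P : Type u) [PartialOrder P] [Fintype P] (n : ℕ) (hn : 2 ≤ n) :
    SC n (OrdComplex.ofPoset P) ≤ TC n (realization (orderComplex P)) := by
  classical
  refine le_leastNat fun k ⟨U, hUo, hUinv, hUcov, hs⟩ => ?_
  choose s hsc hse hsact using hs
  obtain ⟨δ, hδ, hUδ⟩ := lebesgue_number_lemma_of_metric (s := Set.univ)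
    (isCompact_univ (X := Fin n → Polyhedron P)) hUo (fun x _ => Set.mem_iUnion.2 (hUcov x))
  -- The open sets are shrunk to compact invariant ones, on which the sections are uniformly
  -- continuous.
  let C : Fin k → Set (Fin n → Polyhedron P) := fun i => {x | ∀ y, y ∉ U i → δ / 2 ≤ dist x y}
  have hCU : ∀ i, C i ⊆ U i := fun i x hx => by
    by_contra hxU
    have := hx x hxU
    rw [dist_self] at this
    linarith
  have hCc : ∀ i, IsCompact (C i) := fun i => by
    refine IsClosed.isCompact ?_
    have : C i = ⋂ y ∈ (U i)ᶜ, {x | δ / 2 ≤ dist x y} := by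
      ext x; simp [C]
    rw [this]
    exact isClosed_iInter fun y => isClosed_iInter fun _ =>
      isClosed_le continuous_const (continuous_id.dist continuous_const)
  have hCact : ∀ i (g : Equiv.Perm (Fin n)), ∀ x ∈ C i, (fun j => x (g j)) ∈ C i := by
    intro i g x hx y hy
    rw [dist_perm]
    refine hx _ fun hyU => hy ?_
    have := hUinv i g _ hyU
    simpa using this
  -- Constant paths serve as default values outside `U i`.
  let E : Fin k → (Fin n → Polyhedron P) → C(Wedge n, Polyhedron P) := fun i x =>
    if h : x ∈ U i then s i ⟨x, h⟩ else ContinuousMap.const _ (x ⟨0, by omega⟩)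
  have hE : ∀ i x (h : x ∈ U i), E i x = s i ⟨x, h⟩ := fun i x h => dif_pos h
  let G : Fin k → (Fin n → Polyhedron P) → unitInterval → Fin n → Polyhedron P :=
    fun i x t j => E i x (Wedge.mk t j)
  have hGact : ∀ i (g : Equiv.Perm (Fin n)), ∀ x ∈ U i, ∀ t j,
      G i (fun j => x (g j)) t j = G i x t (g j) := by
    intro i g x hx t j
    have h := hsact i g ⟨x, hx⟩ ⟨_, hUinv i g x hx⟩ rfl
    simp only [G, hE i x hx, hE i _ (hUinv i g x hx), h]
    rfl
  have hGc : ∀ i, ContinuousOn (fun q : (Fin n → Polyhedron P) × unitInterval => G i q.1 q.2)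
      (C i ×ˢ Set.univ) := by
    intro i
    have hEc : ContinuousOn (E i) (U i) := by
      rw [continuousOn_iff_continuous_domRestrict]
      refine (hsc i).congr fun x => (hE i x.1 x.2).symm
    refine continuousOn_pi.2 fun j => ?_
    have h₁ : ContinuousOn (fun x => (E i x).comp (Wedge.branch j)) (C i) :=
      (ContinuousMap.continuous_precomp _).comp_continuousOn (hEc.mono (hCU i))
    have h₂ : ContinuousOn (fun q : (Fin n → Polyhedron P) × unitInterval =>
        ((E i q.1).comp (Wedge.branch j)) q.2) (C i ×ˢ Set.univ) :=
      (h₁.comp continuousOn_fst fun q hq => hq.1).eval continuousOn_snd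
    exact h₂
  have hη : ∀ i, ∃ η > 0, ∀ x ∈ C i, ∀ y ∈ C i, ∀ t t', dist x y < η → dist t t' < η →
      dist (G i x t) (G i y t') < (Fintype.card P : ℝ)⁻¹ := by
    intro i
    -- For empty `P` the bound `|P|⁻¹` is `0`, but then there are no points to test.
    rcases isEmpty_or_nonempty P with hP | hP
    · refine ⟨1, one_pos, fun x => ?_⟩
      obtain ⟨p, -⟩ := support_nonempty_of_mem_stdSimplex (x ⟨0, by omega⟩).2.1
      exact hP.elim p
    have hu := ((hCc i).prod isCompact_univ).uniformContinuousOn_of_continuous (hGc i)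
    obtain ⟨η, hη, h⟩ := Metric.uniformContinuousOn_iff.1 hu (Fintype.card P : ℝ)⁻¹ (by positivity)
    exact ⟨η, hη, fun x hx y hy t t' hxy htt => h (x, t) ⟨hx, trivial⟩ (y, t') ⟨hy, trivial⟩
      (max_lt hxy htt)⟩
  choose η hη hGη using hη
  obtain ⟨r, hr, hrδ⟩ : ∃ r, (∀ i, shrink P n ^ r < η i) ∧ shrink P n ^ r < δ / 2 := by
    have h := tendsto_pow_atTop_nhds_zero_of_lt_one (shrink_nonneg P n) (shrink_lt_one P n)
    have h₁ : ∀ᶠ r in Filter.atTop, ∀ i, shrink P n ^ r < η i :=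
      Filter.eventually_all.2 fun i => h.eventually_lt_const (hη i)
    exact (h₁.and (h.eventually_lt_const (half_pos hδ))).exists
  refine (iInf_le _ r).trans (leastNat_le ?_)
  -- The condition is imposed on all faces `τ` of `σ` in order to obtain a subcomplex.
  let L : Fin k → PreAbstractSimplicialComplex (SdVertex P n r) := fun i =>
    { faces := {σ | σ ∈ sdFaces P n r ∧
        ∀ τ, τ ⊆ σ → ∀ hτ : τ ∈ sdFaces P n r, barycentre P n r ⟨τ, hτ⟩ ∈ C i}
      isRelLowerSet_faces := fun {σ} hσ => ⟨sdFaces_nonempty P n hσ.1, fun τ hτσ hτ =>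
        ⟨sdFaces_subset P n hσ.1 hτσ hτ, fun ρ hρ => hσ.2 ρ (hρ.trans hτσ)⟩⟩ }
  have hL : ∀ i, (L i).faces ⊆ sdFaces P n r := fun i σ hσ => hσ.1
  refine ⟨L, hL, ?_, ?_, fun i => ?_⟩
  · intro i g σ hσ
    have hact : ∀ τ ∈ sdFaces P n r, img (vertexAct P n r g) τ ∈ sdFaces P n r := fun τ hτ =>
      (OrdComplex.sdIterMap ((OrdComplex.ofPoset P).perm g) r).map_faces τ hτ
    refine ⟨hact σ hσ.1, fun τ hτσ hτ => ?_⟩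
    obtain ⟨ρ, hρσ, hρ⟩ : ∃ ρ ⊆ σ, img (vertexAct P n r g) ρ = τ := by
      have h : (τ : Set (SdVertex P n r)) ⊆ vertexAct P n r g '' σ := by
        rw [← coe_img]; exact hτσ
      obtain ⟨ρ, hρ, h⟩ := Finset.subset_set_image_iff.1 h
      refine ⟨ρ, hρ, ?_⟩
      rw [← h]
      ext; simp [mem_img]
    subst hρ
    have hne : ρ.Nonempty := by
      obtain ⟨_, h⟩ := sdFaces_nonempty P n hτ
      obtain ⟨v, hv, -⟩ := (mem_img _ _ _).1 h
      exact ⟨v, hv⟩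
    have hρf := sdFaces_subset P n hσ.1 hρσ hne
    rw [barycentre_act P n r g ρ hρf hτ]
    exact hCact i g _ (hσ.2 ρ hρσ hρf)
  · intro σ hσ
    -- A whole `δ`-ball about the barycentre of `σ` lies in `U i`. The barycentres of the faces of
    -- `σ` are less than `δ / 2` away, so they keep distance `δ / 2` from the complement.
    obtain ⟨i, hi⟩ := hUδ (barycentre P n r ⟨σ, hσ⟩) trivial
    refine ⟨i, hσ, fun τ hτσ hτ y hy => ?_⟩
    have h₁ : dist (barycentre P n r ⟨τ, hτ⟩) (barycentre P n r ⟨σ, hσ⟩) < δ / 2 := by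
      refine lt_of_le_of_lt ?_ hrδ
      change dist (average (position P n r) τ) (average (position P n r) σ) ≤ _
      refine dist_average_le (sdFaces_nonempty P n hτ) fun v hv => ?_
      exact dist_point_barycentre_le P n r ⟨σ, hσ⟩ v (hτσ hv)
    have h₂ : δ ≤ dist y (barycentre P n r ⟨σ, hσ⟩) := by
      by_contra hlt
      exact hy (hi (Metric.mem_ball.2 (not_le.1 hlt)))
    have h₃ := dist_triangle y (barycentre P n r ⟨τ, hτ⟩) (barycentre P n r ⟨σ, hσ⟩)
    rw [dist_comm y (barycentre P n r ⟨τ, hτ⟩)] at h₃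
    linarith
  · exact symContiguous_of_section hn (U := C i) (G := G i)
      (fun x a b => congrArg (E i x) (Wedge.mk_zero a b))
      (fun x hx => by
        have h := hse i ⟨x, hCU i hx⟩
        rw [← hE i x (hCU i hx)] at h
        exact h)
      (fun g x hx => hGact i g x (hCU i hx)) (hη i) (hGη i) (hr i) (L i) (hL i)
      (fun σ hσ => hσ.2 σ subset_rfl (hL i hσ))

/-! ### Symmetric homotopies -/

section SymHomotopic

variable {n : ℕ} {B X : Type*} [TopologicalSpace B] [TopologicalSpace X]

/-- Two families of maps `B → X` indexed by `Fin n` are symmetrically homotopic if there is a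
family of homotopies that is equivariant with respect to the relations `R g`, where `R g b b'` says
that `b' = g b`. -/
def SymHomotopic (R : Equiv.Perm (Fin n) → B → B → Prop) (y z : Fin n → C(B, X)) : Prop :=
  ∃ H : ∀ j, (y j).Homotopy (z j), ∀ t j g b b', R g b b' → H j (t, b') = H (g j) (t, b)

variable {R : Equiv.Perm (Fin n) → B → B → Prop} {y z w : Fin n → C(B, X)}

theorem SymHomotopic.symm (h : SymHomotopic R y z) : SymHomotopic R z y := by
  obtain ⟨H, hH⟩ := h
  refine ⟨fun j => (H j).symm, fun t j g b b' hb => ?_⟩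
  simpa only [ContinuousMap.Homotopy.symm_apply] using hH _ j g b b' hb

theorem SymHomotopic.trans (h : SymHomotopic R y z) (h' : SymHomotopic R z w) :
    SymHomotopic R y w := by
  obtain ⟨H, hH⟩ := h
  obtain ⟨H', hH'⟩ := h'
  refine ⟨fun j => (H j).trans (H' j), fun t j g b b' hb => ?_⟩
  rw [ContinuousMap.Homotopy.trans_apply, ContinuousMap.Homotopy.trans_apply]
  split_ifs
  · exact hH _ j g b b' hb
  · exact hH' _ j g b b' hb

/-- The homotopies glue over the wedge because at time `0` they agree in all branches. Local
compactness of `B` makes the product of `B` with the quotient map onto the wedge a quotient map,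
which gives joint continuity. -/
theorem SymHomotopic.exists_section [LocallyCompactSpace B] (h : SymHomotopic R y z)
    (hy : ∀ i j b, y i b = y j b) :
    ∃ s : B → C(Wedge n, X), Continuous s ∧ (∀ b j, s b (Wedge.mk 1 j) = z j b) ∧
      ∀ g b b', R g b b' → s b' = (s b).comp (Wedge.perm g) := by
  obtain ⟨H, hH⟩ := h
  have hHc : Continuous fun q : Fin n × (unitInterval × B) => H q.1 q.2 :=
    continuous_prod_of_discrete_left.2 fun j => (H j).continuous
  let F : B → Wedge n → X := fun b => Quotient.lift (fun a => H a.1 (a.2, b)) (by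
    rintro a a' (rfl | ⟨ha, ha'⟩)
    · rfl
    · rw [ha, ha', ContinuousMap.Homotopy.apply_zero, ContinuousMap.Homotopy.apply_zero, hy])
  have hFc : Continuous fun q : B × Wedge n => F q.1 q.2 := by
    refine Topology.IsQuotientMap.continuous_lift_prod_right
      (f := Quotient.mk (wedgeSetoid n)) isQuotientMap_quotient_mk' ?_
    exact hHc.comp (by fun_prop : Continuous fun q : B × (Fin n × unitInterval) =>
      (q.2.1, (q.2.2, q.1)))
  refine ⟨fun b => ⟨F b, hFc.comp (by fun_prop : Continuous fun a : Wedge n => (b, a))⟩,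
    ContinuousMap.continuous_of_continuous_uncurry _ hFc, fun b j => ?_, fun g b b' hb => ?_⟩
  · exact (H j).apply_one b
  · ext a
    induction a using Quotient.inductionOn with
    | _ a => exact hH a.2 a.1 g b b' hb

end SymHomotopic

/-- When the two supports together form a chain, the segment between the points stays in one
simplex; straight-line homotopies inherit the symmetry of their ends. -/
theorem symHomotopic_of_isChain {n : ℕ} {B : Type*} [TopologicalSpace B] {P : Type u}
    [PartialOrder P] [Fintype P] {R : Equiv.Perm (Fin n) → B → B → Prop}
    {y z : Fin n → C(B, Polyhedron P)}
    (hy : ∀ j g b b', R g b b' → y j b' = y (g j) b)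
    (hz : ∀ j g b b', R g b b' → z j b' = z (g j) b)
    (h : ∀ j b, IsChain (· ≤ ·) (Function.support (y j b).1 ∪ Function.support (z j b).1)) :
    SymHomotopic R y z := by
  let L : Polyhedron P → Polyhedron P → unitInterval → P → ℝ := fun α β t =>
    (1 - (t : ℝ)) • α.1 + (t : ℝ) • β.1
  have hmem : ∀ j b t, L (y j b) (z j b) t ∈ realization (orderComplex P) := by
    intro j b t
    refine mem_realization_iff.2 ⟨?_, (h j b).mono ?_⟩
    · exact convex_stdSimplex ℝ P (y j b).2.1 (z j b).2.1 (sub_nonneg.2 t.2.2) t.2.1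
        (sub_add_cancel _ _)
    · intro p hp
      by_contra hne
      rw [Set.mem_union, Function.mem_support, Function.mem_support, not_or, not_not, not_not]
        at hne
      exact hp (by simp [L, hne.1, hne.2])
  refine ⟨fun j =>
    { toFun := fun q => ⟨L (y j q.2) (z j q.2) q.1, hmem j q.2 q.1⟩
      continuous_toFun := by
        refine Continuous.subtype_mk ?_ _
        have h₁ : Continuous fun q : unitInterval × B => (y j q.2).1 :=
          continuous_subtype_val.comp ((y j).continuous.comp continuous_snd)
        have h₂ : Continuous fun q : unitInterval × B => (z j q.2).1 :=
          continuous_subtype_val.comp ((z j).continuous.comp continuous_snd)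
        have h₃ : Continuous fun q : unitInterval × B => (q.1 : ℝ) :=
          continuous_subtype_val.comp continuous_fst
        exact ((continuous_const.sub h₃).smul h₁).add (h₃.smul h₂)
      map_zero_left := fun b => Subtype.ext (by simp [L])
      map_one_left := fun b => Subtype.ext (by simp [L]) }, fun t j g b b' hb => ?_⟩
  refine Subtype.ext ?_
  change L (y j b') (z j b') t = L (y (g j) b) (z (g j) b) t
  rw [hy j g b b' hb, hz j g b b' hb]

/-! ### Weights and their pushforwards -/

/-- Continuous families of weights on a poset whose supports are nonempty chains. -/
structure Weights (B : Type*) (Z : Type*) [TopologicalSpace B] [PartialOrder Z] where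
  toFun : B → Z → ℝ
  continuous_apply : ∀ z, Continuous fun b => toFun b z
  nonneg : ∀ b z, 0 ≤ toFun b z
  exists_pos : ∀ b, ∃ z, 0 < toFun b z
  isChain : ∀ b, IsChain (· ≤ ·) {z | 0 < toFun b z}

namespace Weights

section Push

variable {B Z : Type*} [TopologicalSpace B] [PartialOrder Z] [Fintype Z] (w : Weights B Z)
  {P : Type u} [PartialOrder P] [Fintype P]

theorem sum_pos (b : B) : 0 < ∑ z, w.toFun b z := by
  obtain ⟨z, hz⟩ := w.exists_pos b
  exact Finset.sum_pos' (fun z _ => w.nonneg b z) ⟨z, Finset.mem_univ z, hz⟩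

open scoped Classical in
theorem exists_of_push_ne_zero {P : Type*} {f : Z → P} {b : B} {p : P}
    (h : (∑ z, if f z = p then w.toFun b z else 0) / ∑ z, w.toFun b z ≠ 0) :
    ∃ z, 0 < w.toFun b z ∧ f z = p := by
  obtain ⟨z, -, hz⟩ := Finset.exists_ne_zero_of_sum_ne_zero (left_ne_zero_of_mul h)
  rw [ne_eq, ite_eq_right_iff, Classical.not_imp] at hz
  exact ⟨z, (w.nonneg b z).lt_of_ne' hz.2, hz.1⟩

open scoped Classical in
/-- The normalized pushforward of weights along a monotone map. -/
def push (f : Z →o P) : C(B, Polyhedron P) where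
  toFun b := ⟨fun p => (∑ z, if f z = p then w.toFun b z else 0) / ∑ z, w.toFun b z, by
    refine mem_realization_iff.2 ⟨⟨fun p => ?_, ?_⟩, ?_⟩
    · refine div_nonneg (Finset.sum_nonneg fun z _ => ?_) (w.sum_pos b).le
      split_ifs
      exacts [w.nonneg b z, le_rfl]
    · rw [← Finset.sum_div, Finset.sum_comm]
      simp only [Finset.sum_ite_eq, Finset.mem_univ, if_true]
      exact div_self (w.sum_pos b).ne'
    · intro p hp q hq _
      obtain ⟨z, hz, rfl⟩ := w.exists_of_push_ne_zero hp
      obtain ⟨z', hz', rfl⟩ := w.exists_of_push_ne_zero hq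
      exact ((w.isChain b).total hz hz').imp (fun h => f.monotone h) (fun h => f.monotone h)⟩
  continuous_toFun := by
    refine Continuous.subtype_mk (continuous_pi fun p => ?_) _
    refine Continuous.div (continuous_finsetSum _ fun z _ => ?_)
      (continuous_finsetSum _ fun z _ => w.continuous_apply z) fun b => (w.sum_pos b).ne'
    split_ifs
    exacts [w.continuous_apply z, continuous_const]

theorem exists_of_mem_support_push {f : Z →o P} {b : B} {p : P}
    (h : p ∈ Function.support (w.push f b).1) : ∃ z, 0 < w.toFun b z ∧ f z = p :=
  w.exists_of_push_ne_zero h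

theorem push_equivariant {a : Z → Z} (ha : Function.Bijective a) {f f' : Z →o P}
    (hf : ∀ z, f (a z) = f' z) {b b' : B} (hb : ∀ z, w.toFun b' (a z) = w.toFun b z) :
    w.push f b' = w.push f' b := by
  classical
  refine Subtype.ext (funext fun p => ?_)
  change (∑ z, if f z = p then w.toFun b' z else 0) / ∑ z, w.toFun b' z =
    (∑ z, if f' z = p then w.toFun b z else 0) / ∑ z, w.toFun b z
  rw [← ha.sum_comp, ← ha.sum_comp (fun z => w.toFun b' z)]
  simp only [hf, hb]

end Push

section Interpolation

variable {Z : Type*} [PartialOrder Z] {P : Type u} [PartialOrder P]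

/-- The map that agrees with `g` on the elements of rank more than `N - k` and with `f` on the
others. -/
def interpolate {f g : Z →o P} (hfg : f ≤ g) {ρ : Z → ℕ} (hρ : StrictMono ρ) (N k : ℕ) :
    Z →o P where
  toFun z := if N < ρ z + k then g z else f z
  monotone' z z' h := by
    have := hρ.monotone h
    dsimp only
    split_ifs
    · exact g.monotone h
    · omega
    · exact (f.monotone h).trans (hfg z')
    · exact f.monotone h

/-- For `z' < z` the values `f z` and `g z'` need not be comparable. Switching one rank at a time
from the top avoids this: if stage `k + 1` uses `g` at `z'`, then stage `k` already uses `g` at `z`.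
-/
theorem interpolate_comparable {f g : Z →o P} (hfg : f ≤ g) {ρ : Z → ℕ} (hρ : StrictMono ρ)
    (N k : ℕ) {z z' : Z} (h : z ≤ z' ∨ z' ≤ z) :
    interpolate hfg hρ N k z ≤ interpolate hfg hρ N (k + 1) z' ∨
      interpolate hfg hρ N (k + 1) z' ≤ interpolate hfg hρ N k z := by
  have hle : ∀ z, interpolate hfg hρ N k z ≤ interpolate hfg hρ N (k + 1) z := by
    intro z
    change (if N < ρ z + k then g z else f z) ≤ if N < ρ z + (k + 1) then g z else f z
    split_ifs
    · exact le_rfl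
    · omega
    · exact hfg z
    · exact le_rfl
  rcases h with h | h
  · exact Or.inl ((hle z).trans ((interpolate hfg hρ N (k + 1)).monotone h))
  · rcases h.lt_or_eq with h' | rfl
    · right
      have := hρ h'
      change (if N < ρ z' + (k + 1) then g z' else f z') ≤ if N < ρ z + k then g z else f z
      split_ifs
      · exact g.monotone h
      · omega
      · exact (f.monotone h).trans (hfg z)
      · exact f.monotone h
    · exact Or.inl (hle _)

theorem symHomotopic_push_of_le {n : ℕ} {B : Type*} [TopologicalSpace B] [Fintype Z] [Fintype P]
    (w : Weights B Z) {R : Equiv.Perm (Fin n) → B → B → Prop}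
    {a : Equiv.Perm (Fin n) → Z → Z} (ha : ∀ g, Function.Bijective (a g))
    (hw : ∀ g b b', R g b b' → ∀ z, w.toFun b' (a g z) = w.toFun b z)
    {ρ : Z → ℕ} (hρ : StrictMono ρ) (hρa : ∀ g z, ρ (a g z) = ρ z)
    {f f' : Fin n → (Z →o P)} (hf : ∀ j g z, f j (a g z) = f (g j) z)
    (hf' : ∀ j g z, f' j (a g z) = f' (g j) z) (hff' : ∀ j, f j ≤ f' j) :
    SymHomotopic R (fun j => w.push (f j)) (fun j => w.push (f' j)) := by
  -- With `N` the maximal rank, stage `0` is `f` and stage `N + 1` is `f'`. Consecutive stages push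
  -- forward into a common simplex.
  let N := Finset.univ.sup ρ
  have hN : ∀ z, ρ z ≤ N := fun z => Finset.le_sup (Finset.mem_univ z)
  let θ : ℕ → Fin n → (Z →o P) := fun k j => interpolate (hff' j) hρ N k
  have hθ : ∀ k j g z, θ k j (a g z) = θ k (g j) z := by
    intro k j g z
    change (if N < ρ (a g z) + k then f' j (a g z) else f j (a g z)) =
      if N < ρ z + k then f' (g j) z else f (g j) z
    rw [hρa, hf, hf']
  have heq : ∀ k j g b b', R g b b' → w.push (θ k j) b' = w.push (θ k (g j)) b :=
    fun k j g b b' hb => w.push_equivariant (ha g) (hθ k j g) (hw g b b' hb)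
  have key : ∀ k, SymHomotopic R (fun j => w.push (θ 0 j)) (fun j => w.push (θ k j)) := by
    intro k
    induction k with
    | zero =>
      refine symHomotopic_of_isChain (heq 0) (heq 0) fun j b => ?_
      rw [Set.union_self]
      exact (mem_realization_iff.1 (w.push (θ 0 j) b).2).2
    | succ k ih =>
      refine ih.trans (symHomotopic_of_isChain (heq k) (heq (k + 1)) fun j b => ?_)
      have hc := fun i => (mem_realization_iff.1 (w.push (θ i j) b).2).2
      rintro p (hp | hp) q (hq | hq) hpq
      · exact hc k hp hq hpq
      · obtain ⟨z, hz, rfl⟩ := w.exists_of_mem_support_push hp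
        obtain ⟨z', hz', rfl⟩ := w.exists_of_mem_support_push hq
        exact interpolate_comparable (hff' j) hρ N k ((w.isChain b).total hz hz')
      · obtain ⟨z, hz, rfl⟩ := w.exists_of_mem_support_push hq
        obtain ⟨z', hz', rfl⟩ := w.exists_of_mem_support_push hp
        exact (interpolate_comparable (hff' j) hρ N k ((w.isChain b).total hz hz')).symm
      · exact hc (k + 1) hp hq hpq
  have h₀ : ∀ j, θ 0 j = f j := fun j => OrderHom.ext _ _ (funext fun z =>
    if_neg (by have := hN z; omega))
  have h₁ : ∀ j, θ (N + 1) j = f' j := fun j => OrderHom.ext _ _ (funext fun z =>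
    if_pos (by omega))
  simpa only [h₀, h₁] using key (N + 1)

end Interpolation

/-! ### Weights on subdivisions -/

/-- This encodes a finite system of strict inequalities by a single continuous nonnegative function.
-/
theorem prod_max_pos_iff {ι : Type*} [Fintype ι] (f : ι → ℝ) :
    0 < ∏ i, max 0 (f i) ↔ ∀ i, 0 < f i := by
  constructor
  · intro h i
    have := Finset.prod_ne_zero_iff.1 h.ne' i (Finset.mem_univ i)
    by_contra hi
    exact this (max_eq_left (not_lt.1 hi))
  · exact fun h => Finset.prod_pos fun i _ => lt_max_of_lt_right (h i)

open scoped Classical in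
/-- The weights on the barycentric subdivision that are supported on the superlevel sets of the
given weights. -/
def subdivide {B : Type*} {Z : Type u} [TopologicalSpace B] [PartialOrder Z] [Fintype Z]
    (w : Weights B Z) : Weights B (FacePoset (orderComplex Z)) where
  -- The product is positive exactly when every element of `s` has positive weight, larger than
  -- every weight outside `s`.
  toFun b s := ∏ q : Z × Z, max 0 (if q.1 ∈ s.1 then
    (if q.2 ∈ s.1 then w.toFun b q.1 else w.toFun b q.1 - w.toFun b q.2) else 1)
  continuous_apply s := by
    refine continuous_finsetProd _ fun q _ => continuous_const.max ?_
    split_ifs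
    exacts [w.continuous_apply _, (w.continuous_apply _).sub (w.continuous_apply _),
      continuous_const]
  nonneg b s := Finset.prod_nonneg fun q _ => le_max_left _ _
  exists_pos b := by
    let s : Finset Z := Finset.univ.filter fun z => 0 < w.toFun b z
    have hs : ∀ z, z ∈ s ↔ 0 < w.toFun b z := fun z => by simp [s]
    obtain ⟨z₀, hz₀⟩ := w.exists_pos b
    refine ⟨⟨s, ⟨z₀, (hs z₀).2 hz₀⟩, (w.isChain b).mono fun z hz => (hs z).1 hz⟩,
      (prod_max_pos_iff _).2 fun q => ?_⟩
    dsimp only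
    split_ifs with h₁ h₂
    · exact (hs _).1 h₁
    · rw [le_antisymm (not_lt.1 fun h => h₂ ((hs _).2 h)) (w.nonneg b q.2), sub_zero]
      exact (hs _).1 h₁
    · exact one_pos
  isChain b := by
    have key : ∀ s ∈ {s : FacePoset (orderComplex Z) | 0 < ∏ q : Z × Z, max 0 (if q.1 ∈ s.1 then
        (if q.2 ∈ s.1 then w.toFun b q.1 else w.toFun b q.1 - w.toFun b q.2) else 1)},
        ∀ z ∈ s.1, ∀ z', z' ∉ s.1 → w.toFun b z' < w.toFun b z := by
      intro s hs z hz z' hz'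
      have := (prod_max_pos_iff _).1 hs (z, z')
      simpa [hz, hz'] using this
    intro s hs t ht _
    -- Two superlevel sets of one function are nested.
    by_contra! hst
    obtain ⟨z, hz, hz'⟩ := Finset.not_subset.1 hst.1
    obtain ⟨z₁, hz₁, hz₁'⟩ := Finset.not_subset.1 hst.2
    exact lt_asymm (key s hs z hz z₁ hz₁') (key t ht z₁ hz₁ z hz')

theorem pos_of_subdivide_pos {B : Type*} {Z : Type u} [TopologicalSpace B] [PartialOrder Z]
    [Fintype Z] (w : Weights B Z) {b : B} {s : FacePoset (orderComplex Z)}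
    (h : 0 < w.subdivide.toFun b s) {z : Z} (hz : z ∈ s.1) : 0 < w.toFun b z := by
  have := (prod_max_pos_iff _).1 h (z, z)
  simpa [hz] using this

theorem subdivide_equivariant {B : Type*} {Z : Type u} [TopologicalSpace B] [PartialOrder Z]
    [Fintype Z] (w : Weights B Z) {a : Z → Z} (ha : Function.Bijective a) {b b' : B}
    (hb : ∀ z, w.toFun b' (a z) = w.toFun b z) {s s' : FacePoset (orderComplex Z)}
    (hs : s'.1 = img a s.1) : w.subdivide.toFun b' s' = w.subdivide.toFun b s := by
  classical
  have hmem : ∀ z, a z ∈ s'.1 ↔ z ∈ s.1 := fun z => by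
    rw [hs, mem_img]
    exact ⟨fun ⟨v, hv, h⟩ => ha.1 h ▸ hv, fun h => ⟨z, h, rfl⟩⟩
  change ∏ q : Z × Z, max 0 (if q.1 ∈ s'.1 then
      (if q.2 ∈ s'.1 then w.toFun b' q.1 else w.toFun b' q.1 - w.toFun b' q.2) else 1) =
    ∏ q : Z × Z, max 0 (if q.1 ∈ s.1 then
      (if q.2 ∈ s.1 then w.toFun b q.1 else w.toFun b q.1 - w.toFun b q.2) else 1)
  rw [← (ha.prodMap ha).prod_comp]
  simp only [Prod.map_fst, Prod.map_snd, hmem, hb]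

/-- The restriction of weights to a subset of the poset. -/
def restrict {B Z : Type*} [TopologicalSpace B] [PartialOrder Z] (w : Weights B Z) (Q : Set Z) :
    Weights {b | ∃ z ∈ Q, 0 < w.toFun b z} Q where
  toFun b z := w.toFun b.1 z.1
  continuous_apply z := (w.continuous_apply z.1).comp continuous_subtype_val
  nonneg b z := w.nonneg b.1 z.1
  exists_pos b := by
    obtain ⟨z, hz, h⟩ := b.2
    exact ⟨⟨z, hz⟩, h⟩
  isChain b := by
    intro z hz z' hz' _
    exact (w.isChain b.1).total hz hz'

/-! ### Weights on `P^n` from the triangulation of a product of simplices -/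

open scoped Classical in
/-- The mass of the elements below `p`. -/
def massLE {P : Type u} [PartialOrder P] [Fintype P] (α : P → ℝ) (p : P) : ℝ :=
  ∑ q, if q ≤ p then α q else 0

open scoped Classical in
/-- The mass of the elements strictly below `p`. -/
def massLT {P : Type u} [PartialOrder P] [Fintype P] (α : P → ℝ) (p : P) : ℝ :=
  ∑ q, if q < p then α q else 0

section Mass

variable {P : Type u} [PartialOrder P] [Fintype P]

theorem massLE_eq (α : P → ℝ) (p : P) : massLE α p = massLT α p + α p := by
  classical
  have h : α p = ∑ q, if q = p then α q else 0 := by simp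
  rw [massLE, massLT, h, ← Finset.sum_add_distrib]
  refine Finset.sum_congr rfl fun q _ => ?_
  by_cases hq : q = p
  · subst hq; simp
  · simp [hq, le_iff_lt_or_eq]

theorem massLE_le_massLT {α : P → ℝ} (hα : ∀ p, 0 ≤ α p) {p p' : P} (h : p < p') :
    massLE α p ≤ massLT α p' := by
  classical
  refine Finset.sum_le_sum fun q _ => ?_
  by_cases hq : q ≤ p
  · rw [if_pos hq, if_pos (hq.trans_lt h)]
  · rw [if_neg hq]
    split_ifs
    exacts [hα q, le_rfl]

theorem continuous_massLE (p : P) : Continuous fun α : P → ℝ => massLE α p := by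
  classical
  refine continuous_finsetSum _ fun q _ => ?_
  split_ifs
  exacts [_root_.continuous_apply q, continuous_const]

theorem continuous_massLT (p : P) : Continuous fun α : P → ℝ => massLT α p := by
  classical
  refine continuous_finsetSum _ fun q _ => ?_
  split_ifs
  exacts [_root_.continuous_apply q, continuous_const]

/-- Weights on `P^n` given by a point of the `n`-th power of the realization of `𝒦(P)`. -/
def ofPow (P : Type u) [PartialOrder P] [Fintype P] (n : ℕ) :
    Weights (Fin n → Polyhedron P) (Fin n → P) where
  -- The support of `x j` is a chain and cuts `[0,1]` into consecutive intervals from `massLT` to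
  -- `massLE`. The weight of `p` is positive exactly when the open intervals of all the `p j` have a
  -- common point.
  toFun x p := ∏ q : Fin n × Fin n,
    max 0 (massLE (x q.1).1 (p q.1) - massLT (x q.2).1 (p q.2))
  continuous_apply p := by
    refine continuous_finsetProd _ fun q _ => continuous_const.max (Continuous.sub ?_ ?_)
    · exact (continuous_massLE _).comp
        (continuous_subtype_val.comp (_root_.continuous_apply q.1))
    · exact (continuous_massLT _).comp
        (continuous_subtype_val.comp (_root_.continuous_apply q.2))
  nonneg x p := Finset.prod_nonneg fun q _ => le_max_left _ _
  exists_pos x := by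
    classical
    -- The last vertices of the supports have intervals that all end at `1`, hence overlap.
    have h : ∀ j, ∃ p, massLE (x j).1 p = 1 ∧ massLT (x j).1 p < 1 := by
      intro j
      obtain ⟨s, hs, hsx⟩ := (x j).2.2
      have hmem : ∀ p, p ∈ s ↔ (x j).1 p ≠ 0 := fun p => by
        rw [← Finset.mem_coe, hsx, Function.mem_support]
      obtain ⟨p, hp, hmax⟩ := exists_last s hs.1 hs.2
      have h₁ : massLE (x j).1 p = 1 := by
        rw [← (x j).2.1.2]
        refine Finset.sum_congr rfl fun q _ => ?_
        split_ifs with hq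
        · rfl
        · by_contra hne
          exact hq (hmax q ((hmem q).2 (Ne.symm hne)))
      refine ⟨p, h₁, ?_⟩
      have h₂ := massLE_eq (x j).1 p
      have h₃ : 0 < (x j).1 p := ((x j).2.1.1 p).lt_of_ne' ((hmem p).1 hp)
      linarith
    choose p hp hp' using h
    refine ⟨p, (prod_max_pos_iff _).2 fun q => ?_⟩
    rw [hp, sub_pos]
    exact hp' q.2
  isChain x := by
    have key : ∀ p ∈ {p : Fin n → P | 0 < ∏ q : Fin n × Fin n,
        max 0 (massLE (x q.1).1 (p q.1) - massLT (x q.2).1 (p q.2))}, ∀ i j,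
        massLT (x j).1 (p j) < massLE (x i).1 (p i) := fun p hp i j =>
      sub_pos.1 ((prod_max_pos_iff _).1 hp (i, j))
    have hsupp : ∀ p ∈ {p : Fin n → P | 0 < ∏ q : Fin n × Fin n,
        max 0 (massLE (x q.1).1 (p q.1) - massLT (x q.2).1 (p q.2))}, ∀ i,
        p i ∈ Function.support (x i).1 := fun p hp i => by
      have h₁ := key p hp i i
      rw [massLE_eq] at h₁
      exact ne_of_gt (by linarith)
    intro p hp p' hp' _
    -- If `p' i < p i` and `p j < p' j`, then a common point of the intervals of `p` would lie both
    -- after and before a common point of those of `p'`.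
    by_contra! h
    simp only [Pi.le_def, not_forall] at h
    obtain ⟨⟨i, hi⟩, j, hj⟩ := h
    have hc := fun k => (mem_realization_iff.1 (x k).2).2.total (hsupp p hp k) (hsupp p' hp' k)
    have hi' : p' i < p i := lt_of_le_not_ge ((hc i).resolve_left hi) hi
    have hj' : p j < p' j := lt_of_le_not_ge ((hc j).resolve_right hj) hj
    have h₁ := massLE_le_massLT (x i).2.1.1 hi'
    have h₂ := massLE_le_massLT (x j).2.1.1 hj'
    have h₃ := key p hp j i
    have h₄ := key p' hp' i j
    linarith

theorem ne_zero_of_ofPow_pos {n : ℕ} {x : Fin n → Polyhedron P} {p : Fin n → P}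
    (h : 0 < (ofPow P n).toFun x p) (j : Fin n) : (x j).1 (p j) ≠ 0 := by
  have h₁ := sub_pos.1 ((prod_max_pos_iff _).1 h (j, j))
  rw [massLE_eq] at h₁
  exact ne_of_gt (by linarith)

theorem ofPow_equivariant {n : ℕ} (g : Equiv.Perm (Fin n)) (x : Fin n → Polyhedron P)
    (p : Fin n → P) :
    (ofPow P n).toFun (fun j => x (g j)) (fun j => p (g j)) = (ofPow P n).toFun x p :=
  (g.prodCongr g).prod_comp fun q : Fin n × Fin n =>
    max 0 (massLE (x q.1).1 (p q.1) - massLT (x q.2).1 (p q.2))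

end Mass

end Weights

/-! ### Action, rank and weights on `sd^r(P^n)` -/

section Subdivision

variable (P : Type u) [PartialOrder P] {n : ℕ}

instance finite_sdIter [Finite P] (r : ℕ) : Finite (sdIter (powPoset P n) r) := by
  induction r with
  | zero => exact inferInstanceAs (Finite (Fin n → P))
  | succ r ih => exact inferInstanceAs (Finite {s : Finset (sdIter (powPoset P n) r) // _})

instance fintype_sdIter [Finite P] (r : ℕ) : Fintype (sdIter (powPoset P n) r) :=
  Fintype.ofFinite _

theorem sdIterMap_leftInverse {Q R : PartOrd.{u}} {f : Q →o R} {f' : R →o Q}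
    (h : Function.LeftInverse f' f) (r : ℕ) :
    Function.LeftInverse (sdIterMap f' r) (sdIterMap f r) := by
  induction r with
  | zero => exact h
  | succ r ih =>
    intro s
    refine Subtype.ext ?_
    change img (sdIterMap f' r) (img (sdIterMap f r) s.1) = s.1
    rw [img_img, img_congr (g := id) fun v _ => ih v]
    exact @Finset.image_id _ _ (Classical.decEq _)

/-- The action of a permutation on `sd^r(P^n)`, as an order isomorphism. -/
def sdActIso (r : ℕ) (g : Equiv.Perm (Fin n)) :
    sdIter (powPoset P n) r ≃o sdIter (powPoset P n) r :=
  have h : ∀ g g' : Equiv.Perm (Fin n), g * g' = 1 →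
      Function.LeftInverse (sdAct P r g') (sdAct P r g) := fun _ _ hg =>
    sdIterMap_leftInverse (fun x => funext fun j =>
      congrArg (x : Fin n → P) (Equiv.ext_iff.1 hg j)) r
  Equiv.toOrderIso
    ⟨sdAct P r g, sdAct P r g⁻¹, h g g⁻¹ (mul_inv_cancel g), h g⁻¹ g (inv_mul_cancel g)⟩
    (sdAct P r g).monotone (sdAct P r g⁻¹).monotone

/-- The number of elements below a given one. -/
def sdRank [Finite P] {r : ℕ} (y : sdIter (powPoset P n) r) : ℕ := (Set.Iic y).ncard

theorem sdRank_strictMono [Finite P] {r : ℕ} :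
    StrictMono (sdRank P : sdIter (powPoset P n) r → ℕ) := fun _ _ h =>
  Set.ncard_lt_ncard (Set.Iic_ssubset_Iic.2 h)

/-- Invariance of the rank makes each stage of the interpolation equivariant. -/
theorem sdRank_sdAct [Finite P] {r : ℕ} (g : Equiv.Perm (Fin n))
    (y : sdIter (powPoset P n) r) : sdRank P (sdAct P r g y) = sdRank P y := by
  have h : Set.Iic (sdAct P r g y) = sdActIso P r g '' Set.Iic y :=
    ((sdActIso P r g).image_Iic y).symm
  rw [sdRank, h, Set.ncard_image_of_injective _ (sdActIso P r g).injective]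
  rfl

theorem sdAct_bijective (r : ℕ) (g : Equiv.Perm (Fin n)) : Function.Bijective (sdAct P r g) :=
  (sdActIso P r g).bijective

variable [Fintype P]

/-- Weights on `sd^r(P^n)` given by a point of the `n`-th power of the realization of `𝒦(P)`. -/
def sdWeights : ∀ r : ℕ, Weights (Fin n → Polyhedron P) (sdIter (powPoset P n) r)
  | 0 => Weights.ofPow P n
  | r + 1 => (sdWeights r).subdivide

theorem sdWeights_equivariant (r : ℕ) (g : Equiv.Perm (Fin n)) (x : Fin n → Polyhedron P)
    (y : sdIter (powPoset P n) r) :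
    (sdWeights P r).toFun (fun j => x (g j)) (sdAct P r g y) = (sdWeights P r).toFun x y := by
  induction r with
  | zero => exact Weights.ofPow_equivariant g x y
  | succ r ih => exact (sdWeights P r).subdivide_equivariant (sdAct_bijective P r g) ih rfl

theorem ne_zero_of_sdWeights_pos (r : ℕ) {x : Fin n → Polyhedron P}
    {y : sdIter (powPoset P n) r} (h : 0 < (sdWeights P r).toFun x y) (j : Fin n) :
    (x j).1 ((tauIter (powPoset P n) r y : Fin n → P) j) ≠ 0 := by
  induction r with
  | zero => exact Weights.ne_zero_of_ofPow_pos h j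
  | succ r ih => exact ih ((sdWeights P r).pos_of_subdivide_pos h (last_mem y.1 y.2.1 y.2.2))

end Subdivision

/-! ### From fences to equivariant sections -/

theorem Fence.mk_le_mk_of_even {n m t : ℕ} (ht : t + 1 ≤ m) (he : Even t) (j : Fin n) :
    (Fence.mk t (Nat.le_of_succ_le ht) j : Fence n m) ≤ Fence.mk (t + 1) ht j :=
  Or.inr ⟨t, t + 1, _, ht, j, rfl, rfl, he, he.add_one, Or.inl rfl⟩

theorem Fence.mk_le_mk_of_odd {n m t : ℕ} (ht : t + 1 ≤ m) (ho : Odd t) (j : Fin n) :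
    (Fence.mk (t + 1) ht j : Fence n m) ≤ Fence.mk t (Nat.le_of_succ_le ht) j :=
  Or.inr ⟨t + 1, t, ht, _, j, rfl, rfl, ho.add_one, ho, Or.inr rfl⟩

/-- The `i`-th open set consists of the points giving positive weight to some element of `Q i`. Only
there can the weights restricted to `Q i` be normalized and pushed forward along the fence. -/
theorem TC_le_CC (P : Type u) [PartialOrder P] [Fintype P] (n : ℕ) :
    TC n (realization (orderComplex P)) ≤ CC n P := by
  classical
  refine le_iInf fun r => le_iInf fun m => le_leastNat fun k ⟨Q, hQ, hQact, hQcov, hs⟩ => ?_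
  have hopen : ∀ i, IsOpen {x : Fin n → Polyhedron P |
      ∃ y ∈ Q i, 0 < (sdWeights P r).toFun x y} := by
    intro i
    have : {x | ∃ y ∈ Q i, 0 < (sdWeights P r).toFun x y} =
        ⋃ y ∈ Q i, {x : Fin n → Polyhedron P | 0 < (sdWeights P r).toFun x y} := by
      ext x; simp
    rw [this]
    exact isOpen_biUnion fun y _ =>
      isOpen_lt continuous_const ((sdWeights P r).continuous_apply y)
  refine leastNat_le ⟨fun i => {x | ∃ y ∈ Q i, 0 < (sdWeights P r).toFun x y}, ?_, ?_, ?_, ?_⟩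
  · exact hopen
  · rintro i g x ⟨y, hy, hxy⟩
    exact ⟨sdAct P r g y, hQact i g y hy, (sdWeights_equivariant P r g x y).symm ▸ hxy⟩
  · intro x
    obtain ⟨y, hy⟩ := (sdWeights P r).exists_pos x
    obtain ⟨i, hi⟩ := hQcov y
    exact ⟨i, y, hi, hy⟩
  · intro i
    obtain ⟨s, hsm, hsact, hsend⟩ := hs i
    let w := (sdWeights P r).restrict (Q i)
    let R : Equiv.Perm (Fin n) → {x | ∃ y ∈ Q i, 0 < (sdWeights P r).toFun x y} →
        {x | ∃ y ∈ Q i, 0 < (sdWeights P r).toFun x y} → Prop :=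
      fun g b b' => b'.1 = fun j => b.1 (g j)
    let a : Equiv.Perm (Fin n) → Q i → Q i := fun g z => ⟨sdAct P r g z.1, hQact i g z.1 z.2⟩
    have ha : ∀ g, Function.Bijective (a g) := fun g => by
      refine Finite.injective_iff_bijective.1 fun z z' h => Subtype.ext ?_
      exact (sdAct_bijective P r g).1 (Subtype.ext_iff.1 h)
    have hw : ∀ g b b', R g b b' → ∀ z, w.toFun b' (a g z) = w.toFun b z := by
      intro g b b' hb z
      change (sdWeights P r).toFun b'.1 (sdAct P r g z.1) = (sdWeights P r).toFun b.1 z.1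
      rw [show b'.1 = fun j => b.1 (g j) from hb]
      exact sdWeights_equivariant P r g b.1 z.1
    let f : ∀ t ≤ m, Fin n → (Q i →o P) := fun t ht j =>
      ⟨fun z => s z (Fence.mk t ht j), fun z z' h => hsm h _⟩
    have hf : ∀ t ht j g z, f t ht j (a g z) = f t ht (g j) z := by
      intro t ht j g z
      change s (a g z) (Fence.mk t ht j) = s z (Fence.mk t ht (g j))
      rw [hsact g z (a g z) rfl, Fence.perm_mk]
    have hρ : StrictMono fun z : Q i => sdRank P z.1 := fun z z' h => sdRank_strictMono P h
    have hρa : ∀ g z, sdRank P (a g z).1 = sdRank P z.1 := fun g z => sdRank_sdAct P g z.1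
    have heq : ∀ t ht j g b b', R g b b' → w.push (f t ht j) b' = w.push (f t ht (g j)) b :=
      fun t ht j g b b' hb => w.push_equivariant (ha g) (hf t ht j g) (hw g b b' hb)
    have key : ∀ t (ht : t ≤ m), SymHomotopic R (fun j => w.push (f 0 (Nat.zero_le m) j))
        (fun j => w.push (f t ht j)) := by
      intro t
      induction t with
      | zero =>
        intro ht
        refine symHomotopic_of_isChain (heq 0 ht) (heq 0 ht) fun j b => ?_
        rw [Set.union_self]
        exact (mem_realization_iff.1 (w.push (f 0 ht j) b).2).2
      | succ t ih =>
        intro ht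
        refine (ih (Nat.le_of_succ_le ht)).trans ?_
        -- The fence goes up from even points and down from odd ones, so the homotopy is reversed in
        -- the odd case.
        rcases Nat.even_or_odd t with he | ho
        · exact Weights.symHomotopic_push_of_le w ha hw hρ hρa (hf t _) (hf (t + 1) ht)
            fun j z => (s z).monotone (Fence.mk_le_mk_of_even ht he j)
        · exact (Weights.symHomotopic_push_of_le w ha hw hρ hρa (hf (t + 1) ht) (hf t _)
            fun j z => (s z).monotone (Fence.mk_le_mk_of_odd ht ho j)).symm
    let e : Fin n → C({x | ∃ y ∈ Q i, 0 < (sdWeights P r).toFun x y}, Polyhedron P) := fun j =>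
      ⟨fun b => b.1 j, (continuous_apply j).comp continuous_subtype_val⟩
    -- A positive weight at `z` forces the `j`-th coordinate of `τ^r z` into the support of `x j`,
    -- so the pushforward lies in the simplex carrying `x j`.
    have hend : SymHomotopic R (fun j => w.push (f m le_rfl j)) e := by
      refine symHomotopic_of_isChain (heq m le_rfl) (fun j g b b' hb => congrFun hb j)
        fun j b => (mem_realization_iff.1 (b.1 j).2).2.mono (Set.union_subset ?_ subset_rfl)
      intro p hp
      obtain ⟨z, hz, rfl⟩ := w.exists_of_mem_support_push hp
      have h : f m le_rfl j z = (tauIter (powPoset P n) r z.1 : Fin n → P) j :=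
        congrFun (hsend z) j
      rw [h]
      exact ne_zero_of_sdWeights_pos P r hz j
    have := (hopen i).locallyCompactSpace
    obtain ⟨σ, hσ, hσ1, hσact⟩ := ((key m le_rfl).trans hend).exists_section
      (fun j j' b => rfl)
    exact ⟨σ, hσ, fun b => funext fun j => hσ1 b j, fun g b b' hb => hσact g b b' hb⟩

end SymComplexity

end

theorem theoremB (P : Type*) [PartialOrder P] [Fintype P] (n : ℕ) (hn : 2 ≤ n) :
    SymComplexity.CC n P = SymComplexity.SC n (SymComplexity.OrdComplex.ofPoset P) ∧
    SymComplexity.SC n (SymComplexity.OrdComplex.ofPoset P) =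
      SymComplexity.TC n (SymComplexity.realization (SymComplexity.orderComplex P)) := by
  have h₁ := SymComplexity.CC_le_SC P n hn
  have h₂ := SymComplexity.SC_le_TC P n hn
  have h₃ := SymComplexity.TC_le_CC P n
  exact ⟨h₁.antisymm (h₂.trans h₃), h₂.antisymm (h₃.trans h₁)⟩
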